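/- **Dynamic theories.** A dynamic theory $\Delta$ consists of sets of variables $\Lambda_V$, atoms $\Lambda_A$ and programs $\Lambda_P$, a nonempty universe $\mathcal U$, a nonempty set of states $\mathcal S$ with evaluations $\mu(v)\in\mathcal U$ for $\mu\in\mathcal S$, $v\in\Lambda_V$, a set $[\![a]\!]\subseteq\mathcal S$ for every atom $a$, a relation $[\![p]\!]\subseteq\mathcal S^2$ for every program $p$, and finite sets $\mathrm{FV}(a),\mathrm{FV}(p)\subseteq\Lambda_V$. Write $\mu=_X\nu$ if $\mu(v)=\nu(v)$ for all $v\in X$. It is required that: (interpolation) for all $\mu,\nu\in\mathcal S$, $X\subseteq\Lambda_V$ there is $\omega\in\mathcal S$ with $\omega=_X\mu$ and $\omega=_{X^c}\nu$; if $\mu=_{\mathrm{FV}(a)}\nu$ then $\mu\in[\![a]\!]\iff\nu\in[\![a]\!]$; if $X\supseteq\mathrm{FV}(p)$, $\mu=_X\nu$ and $(\mu,\omega)\in[\![p]\!]$ then $(\nu,\omega')\in[\![p]\!]$ for some $\omega'=_X\omega$; (extensionality) if $\mu=_{\Lambda_V}\nu$, then $(\mu,\omega)\in[\![p]\!]\iff(\nu,\omega)\in[\![p]\!]$.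 Formulas are $a\mid\neg F\mid F\wedge G\mid\forall v\,F\mid[p]F$, with the usual abbreviations ($\langle p\rangle F=\neg[p]\neg F$); first-order formulas are those without modalities. Here $\mu\models\forall v\,F$ iff $\nu\models F$ for all $\nu=_{\{v\}^c}\mu$, and $\mu\models[p]F$ iff $\nu\models F$ for all $(\mu,\nu)\in[\![p]\!]$. $F$ is valid if it holds in all states. *Semantic variables.* $v$ is free in $F$ if there are $\mu=_{\{v\}^c}\mu'$ with $\mu\models F$, $\mu'\not\models F$; $v$ is free in $p$ if there are $\mu=_{\{v\}^c}\mu'$ and $(\mu,\nu)\in[\![p]\!]$ such that no $\nu'=_{\{v\}^c}\nu$ has $(\mu',\nu')\in[\![p]\!]$; $v$ is bound in $p$ if $\mu(v)\ne\nu(v)$ for some $(\mu,\nu)\in[\![p]\!]$. $\mathrm{VAR}(p)$ is the set of variables free or bound in $p$. Variables $v,w$ are twins if they have the same set of possible values, $\{\mu(v):\mu\in\mathcal S\}=\{\mu(w):\mu\in\mathcal S\}$. **Properties.** $\Delta$ has *finite support* if there are finite sets $\mathrm{BV}(p)$ that contain all variables bound in $p$, for every program $p$. $\Delta$ is *FOL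 expressive* if it has finite support, every variable has infinitely many twins, and there are first-order formulas $v\doteq w$ such that (i) $\mu\models v\doteq w\iff\mu(v)=\mu(w)$ for all twins $v,w$; (ii) for every program $p$ and all nonempty finite vectors $\bar v,\bar w$ of equal length with $v_i,w_i$ twins, $\bar v\cap\bar w=\emptyset$ and $\mathrm{VAR}(p)\subseteq\bar v$, there is a first-order formula $R$ such that $R\leftrightarrow\langle p\rangle\,\bar v\doteq\bar w$ is valid. *Counting data* for $\Delta$ are a set $V_{\mathbb N}\subseteq\Lambda_V$, a map $\mathrm{nat}:\mathcal U\to\mathbb N$ and first-order formulas $\mathrm{nat}_{>0}(v)$, $\mathrm{nat}_=(v,w)$, $\mathrm{nat}_{+1}(v,w)$ for $v,w\in V_{\mathbb N}$. $\Delta$ is *Gödel expressive* with them if: (i) every $v\in V_{\mathbb N}$ and $n\in\mathbb N$ have a state with $\mathrm{nat}(\mu(v))=n$, and for $v\neq w$ in $V_{\mathbb N}$ the formulas $\mathrm{nat}_{>0}(v)$, $\mathrm{nat}_=(v,w)$, $\mathrm{nat}_{+1}(v,w)$ hold in $\mu$ iff $\mathrm{nat}(\mu(v))>0$, $\mathrm{nat}(\mu(v))=\mathrm{nat}(\mu(w))$,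 $\mathrm{nat}(\mu(v))+1=\mathrm{nat}(\mu(w))$, respectively; (ii) $V_{\mathbb N}$ is infinite; (iii) for every variable $v$ there are a variable $w$ and first-order formulas $G(w',n,j,v')$ such that every finite sequence $\delta_1,\dots,\delta_K$ of values of $v$ has a code $\varepsilon$ among the values of $w$ with: for all $n,j\in V_{\mathbb N}$, twins $w'$ of $w$, twins $v'$ of $v$ and states with $\mu(w')=\varepsilon$, $\mathrm{nat}(\mu(n))=K$, we have $\mu\models G(w',n,j,v')$ iff $1\le\mathrm{nat}(\mu(j))\le K$ and $\mu(v')=\delta_{\mathrm{nat}(\mu(j))}$; (iv) there are first-order formulas that express $\mathrm{nat}(\mu(v))<\mathrm{nat}(\mu(w))$ for $v\ne w$ in $V_{\mathbb N}$. **Calculi.** A calculus is a set of rules with finitely many premises and one conclusion (axioms have no premises); $\Gamma\vdash F$ means that $F$ is derivable from $\Gamma$. A calculus is *relatively complete* for $\Delta$ if every valid formula of $\Delta$ is derivable from the set of all valid first-order formulas of $\Delta$. It is *sound* if all its rules preserve validity. The *elementary rules* of $\Delta$ are: all propositional tautologies; modus ponens; from $F$ infer $\forall v\,F$; $\forall v\,F\to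 F$; $\forall v(F\to G)\to(\forall v\,F\to\forall v\,G)$; $F\to\forall v\,F$ for $v$ not free in $F$; (G) from $F$ infer $[p]F$; (V) $F\to[p]F$ if no variable is both free in $F$ and bound in $p$; (B) $\forall v[p]F\leftrightarrow[p]\forall v\,F$ for $v\notin\mathrm{VAR}(p)$; (K) $[p](F\to G)\to([p]F\to[p]G)$. (Free and bound are meant semantically.) **Heterogeneous theories.** Let $\Delta^{(0)},\Delta^{(1)}$ be dynamic theories with disjoint symbol sets, and let $\Lambda_A^c$ be a set of additional atoms, interpreted as subsets of $\mathcal S^{(0)}\times\mathcal S^{(1)}$, each with a finite set of free variables $\subseteq\Lambda_V^{(0)}\cup\Lambda_V^{(1)}$ on whose values alone its truth depends. The *simple heterogeneous theory* $\Delta^S$ has variables $\Lambda_V^{(0)}\cup\Lambda_V^{(1)}$, atoms $\Lambda_A^{(0)}\cup\Lambda_A^{(1)}\cup\Lambda_A^c$, programs $\Lambda_P^{(0)}\cup\Lambda_P^{(1)}$, universe $\mathcal U^{(0)}\cup\mathcal U^{(1)}$ and states $\mathcal S^{(0)}\times\mathcal S^{(1)}$; atoms, programs and variables of $\Delta^{(i)}$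 are interpreted in the $i$-th component of the state, and programs of $\Delta^{(i)}$ change no variable of the other theory. $\Delta^{(0)},\Delta^{(1)}$, with counting data, are *communicating* in $\Delta^S$ if there are first-order formulas of $\Delta^S$ that express $\mathrm{nat}^{(0)}(\mu(v))=\mathrm{nat}^{(1)}(\mu(w))$ for all $v\in V_{\mathbb N}^{(0)},w\in V_{\mathbb N}^{(1)}$, and first-order formulas of $\Delta^S$ that express $\mu(v)=\mu(w)$ for all twins $v,w$ of $\Delta^S$. The *havoc lift* of $\Delta$ adds the programs $v:=*$ with $(\mu,\nu)\in[\![v:=*]\!]\iff\mu=_{\{v\}^c}\nu$. The *regular closure* of $\Delta$ has the programs $p::=r\mid p;q\mid p\cup q\mid{?}H\mid p^*$, with $r\in\Lambda_P$ and $H$ first-order, and the usual relational semantics (tests and zero iterations relate states with equal values of all variables). The *fully heterogeneous theory* $\Delta^H$ is the regular closure of the havoc lift of $\Delta^S$. Let $C_0,C_1$ be calculi of $\Delta^{(0)},\Delta^{(1)}$. The *derived calculus* of $\Delta^H$ is built in three layers, each with the elementary rules of its theory. * For $\Delta^S$: additionally the rule "from $\Gamma$ infer $F$" whenever $\Gamma$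 is finite and $\Gamma\vdash F$ in $C_0$, or in $C_1$. * For the havoc lift: additionally the rule "from $\Gamma$ infer $F$" whenever $\Gamma$ is finite and $\Gamma\vdash F$ in the calculus of $\Delta^S$; and $[v:=*]F\leftrightarrow\forall v\,F$. * For $\Delta^H$: additionally the rule "from $\Gamma$ infer $F$" whenever $\Gamma$ is finite and $\Gamma\vdash F$ in the calculus of the havoc lift; the axioms $[?H]F\leftrightarrow(H\to F)$, $[p;q]F\leftrightarrow[p][q]F$, $[p\cup q]F\leftrightarrow[p]F\wedge[q]F$, $[p^*]F\leftrightarrow F\wedge[p][p^*]F$, $[p^*](F\to[p]F)\to(F\to[p^*]F)$; and for the counting data of either theory and $v\ne w$ in $V_{\mathbb N}$ with $v,w\notin\mathrm{VAR}(p)$ and $w$ not free in $F$, the convergence axiom $$[p^*]\forall v\big(\mathrm{nat}_{>0}(v)\wedge F\to\langle p\rangle\forall w(\mathrm{nat}_{+1}(w,v)\to\forall v(\mathrm{nat}_=(v,w)\to F))\big)\to\forall v\big(F\to\langle p^*\rangle\exists v(\neg\mathrm{nat}_{>0}(v)\wedge F)\big).$$ **Theorem (Relative Completeness of Fully Heterogeneous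 Dynamic Theories).** Let $\Delta^{(0)},\Delta^{(1)}$ be dynamic theories that have finite support, are FOL expressive and Gödel expressive, have relatively complete calculi $C_0,C_1$, and are communicating in the simple heterogeneous theory $\Delta^S$. Then the derived calculus is relatively complete for the fully heterogeneous theory $\Delta^H$. Moreover, if $C_0$ and $C_1$ are sound, then so is the derived calculus. -/

import Mathlib

/-- Formulas over a set `V` of variables, a set `A` of first-order atoms and a set `P` of programs. -/
inductive Fml (V A P : Type*) where
  | atom (a : A) : Fml V A P
  | neg (F : Fml V A P) : Fml V A P
  | and (F G : Fml V A P) : Fml V A P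
  | all (v : V) (F : Fml V A P) : Fml V A P
  | box (p : P) (F : Fml V A P) : Fml V A P

namespace Fml

variable {V A P V' A' P' : Type*}

def imp (F G : Fml V A P) : Fml V A P := neg (and F (neg G))

def iff (F G : Fml V A P) : Fml V A P := and (imp F G) (imp G F)

def ex (v : V) (F : Fml V A P) : Fml V A P := neg (all v (neg F))

def dia (p : P) (F : Fml V A P) : Fml V A P := neg (box p (neg F))

/-- Renaming of the symbols of a formula; used for the inclusions of formula sets. -/
def map (f : V → V') (g : A → A') (h : P → P') : Fml V A P → Fml V' A' P'
  | atom a => atom (g a)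
  | neg F => neg (map f g h F)
  | and F G => and (map f g h F) (map f g h G)
  | all v F => all (f v) (map f g h F)
  | box p F => box (h p) (map f g h F)

/-- `F` is true under every Boolean assignment to the formulas that are not built by `¬` or `∧`. -/
def Tautology (F : Fml V A P) : Prop :=
  ∀ I : Fml V A P → Prop, (∀ G, I (neg G) ↔ ¬ I G) → (∀ G H, I (and G H) ↔ I G ∧ I H) → I F

end Fml

/-- First-order formulas: formulas without modalities, that is, without programs. -/
abbrev FOFml (V A : Type*) := Fml V A Empty

/-- The inclusion of the first-order fragment. -/
def FOFml.toFml {V A : Type*} (P : Type*) (F : FOFml V A) : Fml V A P :=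
  Fml.map id id Empty.elim F

/-- A dynamic theory with variables `V`, atoms `A`, programs `P` and states `S`; its universe `univ`
is a subset of the type `U`. -/
structure DynTheory (U V A P S : Type*) where
  univ : Set U
  univ_nonempty : univ.Nonempty
  state_nonempty : Nonempty S
  eval : S → V → U
  eval_mem : ∀ μ v, eval μ v ∈ univ
  interpolation : ∀ (μ ν : S) (X : Set V), ∃ ω : S, ∀ v,
    (v ∈ X → eval ω v = eval μ v) ∧ (v ∉ X → eval ω v = eval ν v)
  atomEval : A → Set S
  fvAtom : A → Set V
  fvAtom_overapprox : ∀ (a : A) (μ ν : S), (∀ v ∈ fvAtom a, eval μ v = eval ν v) →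
    (μ ∈ atomEval a ↔ ν ∈ atomEval a)
  fvAtom_finite : ∀ a, (fvAtom a).Finite
  progEval : P → S → S → Prop
  fvProg : P → Set V
  fvProg_overapprox : ∀ (p : P) (μ ν ω : S) (X : Set V), fvProg p ⊆ X →
    (∀ v ∈ X, eval μ v = eval ν v) → progEval p μ ω →
    ∃ ω', progEval p ν ω' ∧ ∀ v ∈ X, eval ω v = eval ω' v
  fvProg_finite : ∀ p, (fvProg p).Finite
  extensionality : ∀ (p : P) (μ ν ω : S), (∀ v, eval μ v = eval ν v) →
    (progEval p μ ω ↔ progEval p ν ω)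

namespace DynTheory

section Basic

variable {U V A P S : Type*} (Δ : DynTheory U V A P S)

def EqOn (μ ν : S) (X : Set V) : Prop := ∀ v ∈ X, Δ.eval μ v = Δ.eval ν v

def Sat : Fml V A P → S → Prop
  | .atom a, μ => μ ∈ Δ.atomEval a
  | .neg F, μ => ¬ Sat F μ
  | .and F G, μ => Sat F μ ∧ Sat G μ
  | .all v F, μ => ∀ ν, Δ.EqOn μ ν {v}ᶜ → Sat F ν
  | .box p F, μ => ∀ ν, Δ.progEval p μ ν → Sat F ν

def Valid (F : Fml V A P) : Prop := ∀ μ, Δ.Sat F μ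

/-- Semantics of first-order formulas. -/
def SatFO (F : FOFml V A) (μ : S) : Prop := Δ.Sat (F.toFml P) μ

/-- Semantically free variables of a formula. -/
def fvSem (F : Fml V A P) : Set V :=
  {v | ∃ μ μ', Δ.EqOn μ μ' {v}ᶜ ∧ Δ.Sat F μ ∧ ¬ Δ.Sat F μ'}

/-- Semantically free variables of a program. -/
def fvSemProg (p : P) : Set V :=
  {v | ∃ μ μ' ν, Δ.EqOn μ μ' {v}ᶜ ∧ Δ.progEval p μ ν ∧
    ¬ ∃ ν', Δ.EqOn ν ν' {v}ᶜ ∧ Δ.progEval p μ' ν'}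

/-- Semantically bound variables of a program. -/
def bvSem (p : P) : Set V :=
  {v | ∃ μ ν, Δ.progEval p μ ν ∧ Δ.eval μ v ≠ Δ.eval ν v}

def varSem (p : P) : Set V := Δ.fvSemProg p ∪ Δ.bvSem p

/-- Syntactically free variables of a formula. -/
def fvSyn : Fml V A P → Set V
  | .atom a => Δ.fvAtom a
  | .neg F => fvSyn F
  | .and F G => fvSyn F ∪ fvSyn G
  | .all v F => fvSyn F \ {v}
  | .box p F => Δ.fvProg p ∪ fvSyn F

theorem fvSyn_finite (F : Fml V A P) : (Δ.fvSyn F).Finite := by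
  induction F with
  | atom a => exact Δ.fvAtom_finite a
  | neg F ih => exact ih
  | and F G ihF ihG => exact ihF.union ihG
  | all v F ih => exact ih.subset Set.sdiff_subset
  | box p F ih => exact (Δ.fvProg_finite p).union ih

theorem coincidence (F : Fml V A P) :
    ∀ μ ν, Δ.EqOn μ ν (Δ.fvSyn F) → Δ.Sat F μ → Δ.Sat F ν := by
  induction F with
  | atom a => exact fun μ ν h hs => (Δ.fvAtom_overapprox a μ ν h).1 hs
  | neg F ih => exact fun μ ν h hs hν => hs (ih ν μ (fun v hv => (h v hv).symm) hν)
  | and F G ihF ihG =>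
    exact fun μ ν h hs => ⟨ihF μ ν (fun v hv => h v (Or.inl hv)) hs.1,
      ihG μ ν (fun v hv => h v (Or.inr hv)) hs.2⟩
  | all v F ih =>
    intro μ ν h hs ν' hν'
    obtain ⟨μ', hμ'⟩ := Δ.interpolation ν' μ {v}
    refine ih μ' ν' (fun u hu => ?_) (hs μ' (fun u hu => ((hμ' u).2 hu).symm))
    by_cases huv : u = v
    · exact (hμ' u).1 huv
    · rw [(hμ' u).2 huv, h u ⟨hu, huv⟩, hν' u huv]
  | box p F ih =>
    intro μ ν h hs ω hω
    obtain ⟨ω', h1, h2⟩ := Δ.fvProg_overapprox p ν μ ω (Δ.fvProg p ∪ Δ.fvSyn F)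
      Set.subset_union_left (fun v hv => (h v hv).symm) hω
    exact ih ω' ω (fun v hv => (h2 v (Or.inr hv)).symm) (hs ω' h1)

end Basic

/-! ### Havoc lift -/

section Havoc

variable {U V A P S : Type*}

/-- `Sum.inr v` is the program `v := *`. -/
abbrev HavocProg (V P : Type*) := P ⊕ V

def havoc (Δ : DynTheory U V A P S) : DynTheory U V A (HavocProg V P) S where
  univ := Δ.univ
  univ_nonempty := Δ.univ_nonempty
  state_nonempty := Δ.state_nonempty
  eval := Δ.eval
  eval_mem := Δ.eval_mem
  interpolation := Δ.interpolation
  atomEval := Δ.atomEval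
  fvAtom := Δ.fvAtom
  fvAtom_overapprox := Δ.fvAtom_overapprox
  fvAtom_finite := Δ.fvAtom_finite
  progEval
    | .inl p => Δ.progEval p
    | .inr v => fun μ ν => Δ.EqOn μ ν {v}ᶜ
  fvProg
    | .inl p => Δ.fvProg p
    | .inr _ => ∅
  fvProg_overapprox := by
    rintro (p | x) μ ν ω X hX h hp
    · exact Δ.fvProg_overapprox p μ ν ω X hX h hp
    · obtain ⟨ω', hω'⟩ := Δ.interpolation ω ν {x}
      refine ⟨ω', fun u hu => ((hω' u).2 hu).symm, fun u hu => ?_⟩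
      by_cases hux : u = x
      · exact ((hω' u).1 hux).symm
      · rw [(hω' u).2 hux, ← h u hu, hp u hux]
  fvProg_finite := by
    rintro (p | x)
    · exact Δ.fvProg_finite p
    · exact Set.finite_empty
  extensionality := by
    rintro (p | x) μ ν ω h
    · exact Δ.extensionality p μ ν ω h
    · exact ⟨fun hp u hu => (h u).symm.trans (hp u hu), fun hp u hu => (h u).trans (hp u hu)⟩

end Havoc

/-! ### Regular closure -/

section Regular

/-- Regular programs over `P`; tests are first-order formulas. -/
inductive RegProg (V A P : Type*) where
  | base (r : P) : RegProg V A P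
  | seq (p q : RegProg V A P) : RegProg V A P
  | choice (p q : RegProg V A P) : RegProg V A P
  | test (F : FOFml V A) : RegProg V A P
  | star (p : RegProg V A P) : RegProg V A P

variable {U V A P S : Type*} (Δ : DynTheory U V A P S)

/-- The `n`-fold iteration of a transition relation; zero iterations do not change the value of
any variable. -/
def iterate (R : S → S → Prop) : ℕ → S → S → Prop
  | 0, μ, ν => Δ.EqOn μ ν Set.univ
  | n + 1, μ, ω => ∃ ν, R μ ν ∧ iterate R n ν ω

def regEval : RegProg V A P → S → S → Prop
  | .base r => Δ.progEval r
  | .seq p q => fun μ ω => ∃ ν, regEval p μ ν ∧ regEval q ν ω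
  | .choice p q => fun μ ν => regEval p μ ν ∨ regEval q μ ν
  | .test F => fun μ ν => Δ.SatFO F μ ∧ Δ.EqOn μ ν Set.univ
  | .star p => fun μ ν => ∃ n, Δ.iterate (regEval p) n μ ν

def regFV : RegProg V A P → Set V
  | .base r => Δ.fvProg r
  | .seq p q => regFV p ∪ regFV q
  | .choice p q => regFV p ∪ regFV q
  | .test F => Δ.fvSyn (F.toFml P)
  | .star p => regFV p

theorem regFV_overapprox (p : RegProg V A P) : ∀ (μ ν ω : S) (X : Set V), Δ.regFV p ⊆ X →
    Δ.EqOn μ ν X → Δ.regEval p μ ω → ∃ ω', Δ.regEval p ν ω' ∧ Δ.EqOn ω ω' X := by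
  induction p with
  | base r => exact Δ.fvProg_overapprox r
  | seq p q ihp ihq =>
    rintro μ ν ω X hX h ⟨κ, h1, h2⟩
    obtain ⟨κ', h3, h4⟩ := ihp μ ν κ X (Set.subset_union_left.trans hX) h h1
    obtain ⟨ω', h5, h6⟩ := ihq κ κ' ω X (Set.subset_union_right.trans hX) h4 h2
    exact ⟨ω', ⟨κ', h3, h5⟩, h6⟩
  | choice p q ihp ihq =>
    rintro μ ν ω X hX h (h1 | h1)
    · obtain ⟨ω', h3, h4⟩ := ihp μ ν ω X (Set.subset_union_left.trans hX) h h1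
      exact ⟨ω', Or.inl h3, h4⟩
    · obtain ⟨ω', h3, h4⟩ := ihq μ ν ω X (Set.subset_union_right.trans hX) h h1
      exact ⟨ω', Or.inr h3, h4⟩
  | test F =>
    rintro μ ν ω X hX h ⟨h1, h2⟩
    exact ⟨ν, ⟨Δ.coincidence _ μ ν (fun v hv => h v (hX hv)) h1, fun _ _ => rfl⟩,
      fun v hv => (h2 v trivial).symm.trans (h v hv)⟩
  | star p ih =>
    rintro μ ν ω X hX h ⟨n, hn⟩
    suffices H : ∀ n μ ν, Δ.EqOn μ ν X → Δ.iterate (Δ.regEval p) n μ ω →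
        ∃ ω', Δ.iterate (Δ.regEval p) n ν ω' ∧ Δ.EqOn ω ω' X by
      obtain ⟨ω', h1, h2⟩ := H n μ ν h hn
      exact ⟨ω', ⟨n, h1⟩, h2⟩
    intro n
    induction n with
    | zero =>
      intro μ ν h h1
      exact ⟨ν, fun _ _ => rfl, fun v hv => (h1 v trivial).symm.trans (h v hv)⟩
    | succ n ihn =>
      rintro μ ν h ⟨κ, h1, h2⟩
      obtain ⟨κ', h3, h4⟩ := ih μ ν κ X hX h h1
      obtain ⟨ω', h5, h6⟩ := ihn κ κ' h4 h2
      exact ⟨ω', ⟨κ', h3, h5⟩, h6⟩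

theorem regFV_finite (p : RegProg V A P) : (Δ.regFV p).Finite := by
  induction p with
  | base r => exact Δ.fvProg_finite r
  | seq p q ihp ihq => exact ihp.union ihq
  | choice p q ihp ihq => exact ihp.union ihq
  | test F => exact Δ.fvSyn_finite _
  | star p ih => exact ih

theorem regEval_extensional (p : RegProg V A P) : ∀ (μ ν ω : S),
    (∀ v, Δ.eval μ v = Δ.eval ν v) → Δ.regEval p μ ω → Δ.regEval p ν ω := by
  induction p with
  | base r => exact fun μ ν ω h => (Δ.extensionality r μ ν ω h).1
  | seq p q ihp ihq => exact fun μ ν ω h ⟨κ, h1, h2⟩ => ⟨κ, ihp μ ν κ h h1, h2⟩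
  | choice p q ihp ihq => exact fun μ ν ω h => Or.imp (ihp μ ν ω h) (ihq μ ν ω h)
  | test F =>
    exact fun μ ν ω h ⟨h1, h2⟩ => ⟨Δ.coincidence _ μ ν (fun v _ => h v) h1,
      fun v hv => (h v).symm.trans (h2 v hv)⟩
  | star p ih =>
    rintro μ ν ω h ⟨n, hn⟩
    cases n with
    | zero => exact ⟨0, fun v hv => (h v).symm.trans (hn v hv)⟩
    | succ n =>
      obtain ⟨κ, h1, h2⟩ := hn
      exact ⟨n + 1, κ, ih μ ν κ h h1, h2⟩

def regular : DynTheory U V A (RegProg V A P) S where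
  univ := Δ.univ
  univ_nonempty := Δ.univ_nonempty
  state_nonempty := Δ.state_nonempty
  eval := Δ.eval
  eval_mem := Δ.eval_mem
  interpolation := Δ.interpolation
  atomEval := Δ.atomEval
  fvAtom := Δ.fvAtom
  fvAtom_overapprox := Δ.fvAtom_overapprox
  fvAtom_finite := Δ.fvAtom_finite
  progEval := Δ.regEval
  fvProg := Δ.regFV
  fvProg_overapprox := Δ.regFV_overapprox
  fvProg_finite := Δ.regFV_finite
  extensionality := fun p μ ν ω h =>
    ⟨Δ.regEval_extensional p μ ν ω h, Δ.regEval_extensional p ν μ ω fun v => (h v).symm⟩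

end Regular

/-! ### Heterogeneous theories -/

section Heterogeneous

variable {U V₀ A₀ P₀ S₀ V₁ A₁ P₁ S₁ Ac : Type*}

/-- Variable evaluation in the heterogeneous state space. -/
def hetEval (Δ₀ : DynTheory U V₀ A₀ P₀ S₀) (Δ₁ : DynTheory U V₁ A₁ P₁ S₁)
    (μ : S₀ × S₁) : V₀ ⊕ V₁ → U
  | .inl v => Δ₀.eval μ.1 v
  | .inr v => Δ₁.eval μ.2 v

/-- A set `Ac` of heterogeneous atoms over two dynamic theories. -/
structure HetAtoms (Δ₀ : DynTheory U V₀ A₀ P₀ S₀) (Δ₁ : DynTheory U V₁ A₁ P₁ S₁)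
    (Ac : Type*) where
  atomEval : Ac → Set (S₀ × S₁)
  fvAtom : Ac → Set (V₀ ⊕ V₁)
  fvAtom_overapprox : ∀ (a : Ac) (μ ν : S₀ × S₁),
    (∀ v ∈ fvAtom a, hetEval Δ₀ Δ₁ μ v = hetEval Δ₀ Δ₁ ν v) → (μ ∈ atomEval a ↔ ν ∈ atomEval a)
  fvAtom_finite : ∀ a, (fvAtom a).Finite

/-- The simple heterogeneous dynamic theory. A program of one theory leaves the variables of the
other theory unchanged (up to extensional equality of states, as for tests). -/
def simpleHet (Δ₀ : DynTheory U V₀ A₀ P₀ S₀) (Δ₁ : DynTheory U V₁ A₁ P₁ S₁)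
    (Θ : HetAtoms Δ₀ Δ₁ Ac) :
    DynTheory U (V₀ ⊕ V₁) (A₀ ⊕ A₁ ⊕ Ac) (P₀ ⊕ P₁) (S₀ × S₁) where
  univ := Δ₀.univ ∪ Δ₁.univ
  univ_nonempty := Δ₀.univ_nonempty.inl
  state_nonempty := by
    have := Δ₀.state_nonempty
    have := Δ₁.state_nonempty
    infer_instance
  eval := hetEval Δ₀ Δ₁
  eval_mem := by
    rintro μ (v | v)
    · exact Or.inl (Δ₀.eval_mem _ _)
    · exact Or.inr (Δ₁.eval_mem _ _)
  interpolation := by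
    intro μ ν X
    obtain ⟨ω₀, h₀⟩ := Δ₀.interpolation μ.1 ν.1 (Sum.inl ⁻¹' X)
    obtain ⟨ω₁, h₁⟩ := Δ₁.interpolation μ.2 ν.2 (Sum.inr ⁻¹' X)
    refine ⟨(ω₀, ω₁), ?_⟩
    rintro (v | v)
    · exact h₀ v
    · exact h₁ v
  atomEval
    | .inl a => {μ | μ.1 ∈ Δ₀.atomEval a}
    | .inr (.inl a) => {μ | μ.2 ∈ Δ₁.atomEval a}
    | .inr (.inr a) => Θ.atomEval a
  fvAtom
    | .inl a => Sum.inl '' Δ₀.fvAtom a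
    | .inr (.inl a) => Sum.inr '' Δ₁.fvAtom a
    | .inr (.inr a) => Θ.fvAtom a
  fvAtom_overapprox := by
    rintro (a | a | a) μ ν h
    · exact Δ₀.fvAtom_overapprox a _ _ fun v hv => h _ ⟨v, hv, rfl⟩
    · exact Δ₁.fvAtom_overapprox a _ _ fun v hv => h _ ⟨v, hv, rfl⟩
    · exact Θ.fvAtom_overapprox a μ ν h
  fvAtom_finite := by
    rintro (a | a | a)
    · exact (Δ₀.fvAtom_finite a).image _
    · exact (Δ₁.fvAtom_finite a).image _
    · exact Θ.fvAtom_finite a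
  progEval
    | .inl p => fun μ ν => Δ₀.progEval p μ.1 ν.1 ∧ Δ₁.EqOn μ.2 ν.2 Set.univ
    | .inr p => fun μ ν => Δ₀.EqOn μ.1 ν.1 Set.univ ∧ Δ₁.progEval p μ.2 ν.2
  fvProg
    | .inl p => Sum.inl '' Δ₀.fvProg p
    | .inr p => Sum.inr '' Δ₁.fvProg p
  fvProg_overapprox := by
    rintro (p | p) μ ν ω X hX h ⟨h1, h2⟩
    · obtain ⟨ω', h3, h4⟩ := Δ₀.fvProg_overapprox p μ.1 ν.1 ω.1 (Sum.inl ⁻¹' X)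
        (fun v hv => hX ⟨v, hv, rfl⟩) (fun v hv => h _ hv) h1
      refine ⟨(ω', ν.2), ⟨h3, fun _ _ => rfl⟩, ?_⟩
      rintro (v | v) hv
      · exact h4 v hv
      · exact (h2 v trivial).symm.trans (h _ hv)
    · obtain ⟨ω', h3, h4⟩ := Δ₁.fvProg_overapprox p μ.2 ν.2 ω.2 (Sum.inr ⁻¹' X)
        (fun v hv => hX ⟨v, hv, rfl⟩) (fun v hv => h _ hv) h2
      refine ⟨(ν.1, ω'), ⟨fun _ _ => rfl, h3⟩, ?_⟩
      rintro (v | v) hv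
      · exact (h1 v trivial).symm.trans (h _ hv)
      · exact h4 v hv
  fvProg_finite := by
    rintro (p | p)
    · exact (Δ₀.fvProg_finite p).image _
    · exact (Δ₁.fvProg_finite p).image _
  extensionality := by
    rintro (p | p) μ ν ω h
    · exact and_congr (Δ₀.extensionality p _ _ _ fun v => h (.inl v))
        (forall₂_congr fun v _ => Eq.congr_left (h (.inr v)))
    · exact and_congr (forall₂_congr fun v _ => Eq.congr_left (h (.inl v)))
        (Δ₁.extensionality p _ _ _ fun v => h (.inr v))

/-- The fully heterogeneous dynamic theory. -/
def fullHet (Δ₀ : DynTheory U V₀ A₀ P₀ S₀) (Δ₁ : DynTheory U V₁ A₁ P₁ S₁)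
    (Θ : HetAtoms Δ₀ Δ₁ Ac) :
    DynTheory U (V₀ ⊕ V₁) (A₀ ⊕ A₁ ⊕ Ac)
      (RegProg (V₀ ⊕ V₁) (A₀ ⊕ A₁ ⊕ Ac) (HavocProg (V₀ ⊕ V₁) (P₀ ⊕ P₁))) (S₀ × S₁) :=
  (simpleHet Δ₀ Δ₁ Θ).havoc.regular

end Heterogeneous

/-! ### Meta-properties -/

section Meta

variable {U V A P S : Type*} (Δ : DynTheory U V A P S)

/-- The admissible values of a variable. -/
def valueSet (v : V) : Set U := {δ | ∃ μ, Δ.eval μ v = δ}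

def Twin (v w : V) : Prop := Δ.valueSet v = Δ.valueSet w

def FiniteSupport : Prop :=
  ∃ bv : P → Set V, (∀ p, Δ.bvSem p ⊆ bv p) ∧ ∀ p, (bv p).Finite

/-- `eq v w` is a first-order formula that expresses equality of the twin variables `v`, `w`. -/
def IsEqPredicate (eq : V → V → FOFml V A) : Prop :=
  ∀ v w, Δ.Twin v w → ∀ μ, Δ.SatFO (eq v w) μ ↔ Δ.eval μ v = Δ.eval μ w

/-- Componentwise equality of two vectors of variables, given as the nonempty list `a :: l` of the
pairs of their components (there is no primitive formula for the empty conjunction). -/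
def eqVec (eq : V → V → FOFml V A) : V × V → List (V × V) → FOFml V A
  | a, [] => eq a.1 a.2
  | a, b :: l => Fml.and (eq a.1 a.2) (eqVec eq b l)

/-- Every program `p` has, for every pair of disjoint twin vectors of which the first one covers
the variables of `p`, a first-order rendition. -/
def HasRendition (eq : V → V → FOFml V A) : Prop :=
  ∀ (p : P) (a : V × V) (l : List (V × V)),
    (∀ x ∈ a :: l, Δ.Twin x.1 x.2) →
    (∀ v ∈ Δ.varSem p, ∃ x ∈ a :: l, x.1 = v) →
    (∀ x ∈ a :: l, ∀ y ∈ a :: l, x.1 ≠ y.2) →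
    ∃ R : FOFml V A, Δ.Valid (.iff (R.toFml P) (.dia p ((eqVec eq a l).toFml P)))

structure FOLExpressive : Prop where
  finite_support : Δ.FiniteSupport
  infinite_variables : ∀ v, {w | Δ.Twin v w}.Infinite
  rendition : ∃ eq : V → V → FOFml V A, Δ.IsEqPredicate eq ∧ Δ.HasRendition eq

end Meta

end DynTheory

/-- The material for counting in a dynamic theory: a set `VN` of variables, a map from the universe
to the natural numbers, and the formulas for positivity, equality and successor. -/
structure NatData (U V A : Type*) where
  VN : Set V
  toNat : U → ℕ
  pos : VN → FOFml V A
  eq : VN → VN → FOFml V A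
  succ : VN → VN → FOFml V A

namespace DynTheory

section Meta

variable {U V A P S : Type*} (Δ : DynTheory U V A P S) (N : NatData U V A)

structure InductivelyExpressive : Prop where
  integer_expressive : ∀ v ∈ N.VN, ∀ n : ℕ, ∃ μ, N.toNat (Δ.eval μ v) = n
  pos_sound : ∀ (v : N.VN) μ, Δ.SatFO (N.pos v) μ ↔ 0 < N.toNat (Δ.eval μ v)
  eq_sound : ∀ (v w : N.VN), v ≠ w → ∀ μ,
    Δ.SatFO (N.eq v w) μ ↔ N.toNat (Δ.eval μ v) = N.toNat (Δ.eval μ w)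
  succ_sound : ∀ (v w : N.VN), v ≠ w → ∀ μ,
    Δ.SatFO (N.succ v w) μ ↔ N.toNat (Δ.eval μ v) + 1 = N.toNat (Δ.eval μ w)

/-- The formula `G w' n j v'` says that the component with index `j` (counted from 1) of the
sequence of length `n` that `w'` encodes is the value of `v'`. -/
def GoedelizationSupport (v : V) : Prop :=
  ∃ (w : V) (G : V → N.VN → N.VN → V → FOFml V A),
    ∀ (K : ℕ) (δ : Fin K → U), (∀ k, δ k ∈ Δ.valueSet v) →
      ∃ ε ∈ Δ.valueSet w, ∀ (n j : N.VN) (w' v' : V), Δ.Twin w w' → Δ.Twin v v' →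
        ∀ μ, Δ.eval μ w' = ε → N.toNat (Δ.eval μ n) = K →
          (Δ.SatFO (G w' n j v') μ ↔
            ∃ k : Fin K, N.toNat (Δ.eval μ j) = (k : ℕ) + 1 ∧ Δ.eval μ v' = δ k)

/-- Gödel expressiveness. The set `VN` is infinite, so that fresh counting variables exist. -/
structure GoedelExpressive : Prop where
  inductively_expressive : Δ.InductivelyExpressive N
  infinite_nat_variables : N.VN.Infinite
  goedel_formulas : ∀ v, Δ.GoedelizationSupport N v
  less_predicate : ∃ lt : N.VN → N.VN → FOFml V A, ∀ (v w : N.VN), v ≠ w → ∀ μ,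
    Δ.SatFO (lt v w) μ ↔ N.toNat (Δ.eval μ v) < N.toNat (Δ.eval μ w)

end Meta

/-- `Δ₀`, `Δ₁` are communicating in their simple heterogeneous theory. -/
structure Communicating {U V₀ A₀ P₀ S₀ V₁ A₁ P₁ S₁ Ac : Type*}
    (Δ₀ : DynTheory U V₀ A₀ P₀ S₀) (Δ₁ : DynTheory U V₁ A₁ P₁ S₁) (Θ : HetAtoms Δ₀ Δ₁ Ac)
    (N₀ : NatData U V₀ A₀) (N₁ : NatData U V₁ A₁) : Prop where
  nat_communication : ∃ natEq : N₀.VN → N₁.VN → FOFml (V₀ ⊕ V₁) (A₀ ⊕ A₁ ⊕ Ac),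
    ∀ (v : N₀.VN) (w : N₁.VN) (μ : S₀ × S₁), (simpleHet Δ₀ Δ₁ Θ).SatFO (natEq v w) μ ↔
      N₀.toNat ((simpleHet Δ₀ Δ₁ Θ).eval μ (.inl v)) =
        N₁.toNat ((simpleHet Δ₀ Δ₁ Θ).eval μ (.inr w))
  eq_predicate : ∃ eq, (simpleHet Δ₀ Δ₁ Θ).IsEqPredicate eq

end DynTheory

/-! ### Proof calculi -/

/-- A proof calculus: a set of inference rules, each with a finite list of premises and a
conclusion. Axioms are rules without premises. -/
abbrev Calculus (V A P : Type*) := List (Fml V A P) → Fml V A P → Prop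

/-- `C.Derives Γ F`: the formula `F` can be derived from `Γ` in the calculus `C`. -/
inductive Calculus.Derives {V A P : Type*} (C : Calculus V A P) (Γ : Set (Fml V A P)) :
    Fml V A P → Prop where
  | hyp {F : Fml V A P} (h : F ∈ Γ) : Derives C Γ F
  | rule {L : List (Fml V A P)} {F : Fml V A P} (h : C L F) (hL : ∀ G ∈ L, Derives C Γ G) :
      Derives C Γ F

/-- Every rule preserves validity (in particular every axiom is valid). -/
def Calculus.Sound {U V A P S : Type*} (C : Calculus V A P) (Δ : DynTheory U V A P S) : Prop :=
  ∀ L F, C L F → (∀ G ∈ L, Δ.Valid G) → Δ.Valid F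

/-- Every valid formula is derivable from the set of all valid first-order formulas. -/
def Calculus.RelativelyComplete {U V A P S : Type*} (C : Calculus V A P)
    (Δ : DynTheory U V A P S) : Prop :=
  ∀ F : Fml V A P, Δ.Valid F →
    C.Derives {H | ∃ G : FOFml V A, H = G.toFml P ∧ Δ.Valid H} F

open DynTheory

/-- Propositional and first-order reasoning, together with the elementary rules `G`, `V`, `B`, `K`
for modalities. As atoms are opaque, quantifier instantiation is `∀ v F → F`. -/
inductive ElementaryRule {U V A P S : Type*} (Δ : DynTheory U V A P S) : Calculus V A P where
  | taut (F : Fml V A P) (h : F.Tautology) : ElementaryRule Δ [] F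
  | mp (F G : Fml V A P) : ElementaryRule Δ [F, .imp F G] G
  | gen (v : V) (F : Fml V A P) : ElementaryRule Δ [F] (.all v F)
  | allElim (v : V) (F : Fml V A P) : ElementaryRule Δ [] (.imp (.all v F) F)
  | allDistrib (v : V) (F G : Fml V A P) :
      ElementaryRule Δ [] (.imp (.all v (.imp F G)) (.imp (.all v F) (.all v G)))
  | allVacuous (v : V) (F : Fml V A P) (h : v ∉ Δ.fvSem F) :
      ElementaryRule Δ [] (.imp F (.all v F))
  | G (p : P) (F : Fml V A P) : ElementaryRule Δ [F] (.box p F)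
  | V (p : P) (F : Fml V A P) (h : Δ.fvSem F ∩ Δ.bvSem p = ∅) :
      ElementaryRule Δ [] (.imp F (.box p F))
  | B (p : P) (v : V) (F : Fml V A P) (h : v ∉ Δ.varSem p) :
      ElementaryRule Δ [] (.iff (.all v (.box p F)) (.box p (.all v F)))
  | K (p : P) (F G : Fml V A P) :
      ElementaryRule Δ [] (.imp (.box p (.imp F G)) (.imp (.box p F) (.box p G)))

/-- The calculus of the simple heterogeneous theory: derivations of the two component calculi are
reused through the reduction rules. -/
inductive SimpleHetCalculus {U V₀ A₀ P₀ S₀ V₁ A₁ P₁ S₁ Ac : Type*}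
    (Δ₀ : DynTheory U V₀ A₀ P₀ S₀) (Δ₁ : DynTheory U V₁ A₁ P₁ S₁) (Θ : HetAtoms Δ₀ Δ₁ Ac)
    (C₀ : Calculus V₀ A₀ P₀) (C₁ : Calculus V₁ A₁ P₁) :
    Calculus (V₀ ⊕ V₁) (A₀ ⊕ A₁ ⊕ Ac) (P₀ ⊕ P₁) where
  | elementary {L F} (h : ElementaryRule (simpleHet Δ₀ Δ₁ Θ) L F) :
      SimpleHetCalculus Δ₀ Δ₁ Θ C₀ C₁ L F
  | reduction₀ {L : List (Fml V₀ A₀ P₀)} {F : Fml V₀ A₀ P₀} (h : C₀.Derives {G | G ∈ L} F) :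
      SimpleHetCalculus Δ₀ Δ₁ Θ C₀ C₁ (L.map (Fml.map .inl .inl .inl)) (F.map .inl .inl .inl)
  | reduction₁ {L : List (Fml V₁ A₁ P₁)} {F : Fml V₁ A₁ P₁} (h : C₁.Derives {G | G ∈ L} F) :
      SimpleHetCalculus Δ₀ Δ₁ Θ C₀ C₁ (L.map (Fml.map .inr (fun a => .inr (.inl a)) .inr))
        (F.map .inr (fun a => .inr (.inl a)) .inr)

/-- The calculus of the havoc lift of `Δ`, built on a calculus `C` of `Δ`. -/
inductive HavocCalculus {U V A P S : Type*} (Δ : DynTheory U V A P S) (C : Calculus V A P) :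
    Calculus V A (HavocProg V P) where
  | elementary {L F} (h : ElementaryRule Δ.havoc L F) : HavocCalculus Δ C L F
  | reduction {L : List (Fml V A P)} {F : Fml V A P} (h : C.Derives {G | G ∈ L} F) :
      HavocCalculus Δ C (L.map (Fml.map id id .inl)) (F.map id id .inl)
  | havoc (v : V) (F : Fml V A (HavocProg V P)) :
      HavocCalculus Δ C [] (.iff (.box (.inr v) F) (.all v F))

/-- The loop convergence axiom for the loop `p*`, with counter `v` and auxiliary variable `w`. -/
def convergenceAxiom {U V A P : Type*} (N : NatData U V A) (p : RegProg V A P) (v w : N.VN)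
    (F : Fml V A (RegProg V A P)) : Fml V A (RegProg V A P) :=
  .imp
    (.box (.star p) (.all v (.imp (.and ((N.pos v).toFml _) F)
      (.dia p (.all w (.imp ((N.succ w v).toFml _) (.all v (.imp ((N.eq v w).toFml _) F))))))))
    (.all v (.imp F (.dia (.star p) (.ex v (.and (.neg ((N.pos v).toFml _)) F)))))

/-- The calculus of the regular closure of `Δ`, built on a calculus `C` of `Δ`; loop convergence
is available for all counting data in `𝒩`. -/
inductive RegularCalculus {U V A P S : Type*} (Δ : DynTheory U V A P S) (C : Calculus V A P)
    (𝒩 : Set (NatData U V A)) : Calculus V A (RegProg V A P) where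
  | elementary {L F} (h : ElementaryRule Δ.regular L F) : RegularCalculus Δ C 𝒩 L F
  | reduction {L : List (Fml V A P)} {F : Fml V A P} (h : C.Derives {G | G ∈ L} F) :
      RegularCalculus Δ C 𝒩 (L.map (Fml.map id id .base)) (F.map id id .base)
  | test (H : FOFml V A) (F : Fml V A (RegProg V A P)) :
      RegularCalculus Δ C 𝒩 [] (.iff (.box (.test H) F) (.imp (H.toFml _) F))
  | seq (p q : RegProg V A P) (F : Fml V A (RegProg V A P)) :
      RegularCalculus Δ C 𝒩 [] (.iff (.box (.seq p q) F) (.box p (.box q F)))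
  | choice (p q : RegProg V A P) (F : Fml V A (RegProg V A P)) :
      RegularCalculus Δ C 𝒩 [] (.iff (.box (.choice p q) F) (.and (.box p F) (.box q F)))
  | star (p : RegProg V A P) (F : Fml V A (RegProg V A P)) :
      RegularCalculus Δ C 𝒩 [] (.iff (.box (.star p) F) (.and F (.box p (.box (.star p) F))))
  | induction (p : RegProg V A P) (F : Fml V A (RegProg V A P)) :
      RegularCalculus Δ C 𝒩 []
        (.imp (.box (.star p) (.imp F (.box p F))) (.imp F (.box (.star p) F)))
  | convergence (N : NatData U V A) (hN : N ∈ 𝒩) (p : RegProg V A P) (v w : N.VN)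
      (F : Fml V A (RegProg V A P)) (hvw : v ≠ w) (hw : (w : V) ∉ Δ.regular.fvSem F)
      (hvp : (v : V) ∉ Δ.regular.varSem p) (hwp : (w : V) ∉ Δ.regular.varSem p) :
      RegularCalculus Δ C 𝒩 [] (convergenceAxiom N p v w F)

section

variable {U V₀ A₀ V₁ A₁ : Type*}

/-- Counting data of the first theory, inherited by the heterogeneous theory. -/
def NatData.lift₀ (N : NatData U V₀ A₀) (V₁ A₁ Ac : Type*) :
    NatData U (V₀ ⊕ V₁) (A₀ ⊕ A₁ ⊕ Ac) where
  VN := {x | Sum.elim (· ∈ N.VN) (fun _ => False) x}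
  toNat := N.toNat
  pos
    | ⟨.inl v, hv⟩ => (N.pos ⟨v, hv⟩).map .inl .inl id
  eq
    | ⟨.inl v, hv⟩, ⟨.inl w, hw⟩ => (N.eq ⟨v, hv⟩ ⟨w, hw⟩).map .inl .inl id
  succ
    | ⟨.inl v, hv⟩, ⟨.inl w, hw⟩ => (N.succ ⟨v, hv⟩ ⟨w, hw⟩).map .inl .inl id

/-- Counting data of the second theory, inherited by the heterogeneous theory. -/
def NatData.lift₁ (N : NatData U V₁ A₁) (V₀ A₀ Ac : Type*) :
    NatData U (V₀ ⊕ V₁) (A₀ ⊕ A₁ ⊕ Ac) where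
  VN := {x | Sum.elim (fun _ => False) (· ∈ N.VN) x}
  toNat := N.toNat
  pos
    | ⟨.inr v, hv⟩ => (N.pos ⟨v, hv⟩).map .inr (fun a => .inr (.inl a)) id
  eq
    | ⟨.inr v, hv⟩, ⟨.inr w, hw⟩ => (N.eq ⟨v, hv⟩ ⟨w, hw⟩).map .inr (fun a => .inr (.inl a)) id
  succ
    | ⟨.inr v, hv⟩, ⟨.inr w, hw⟩ => (N.succ ⟨v, hv⟩ ⟨w, hw⟩).map .inr (fun a => .inr (.inl a)) id

end

/-- The calculus of the fully heterogeneous theory, derived from calculi of the two theories. -/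
def FullHetCalculus {U V₀ A₀ P₀ S₀ V₁ A₁ P₁ S₁ Ac : Type*}
    (Δ₀ : DynTheory U V₀ A₀ P₀ S₀) (Δ₁ : DynTheory U V₁ A₁ P₁ S₁) (Θ : HetAtoms Δ₀ Δ₁ Ac)
    (N₀ : NatData U V₀ A₀) (N₁ : NatData U V₁ A₁)
    (C₀ : Calculus V₀ A₀ P₀) (C₁ : Calculus V₁ A₁ P₁) :
    Calculus (V₀ ⊕ V₁) (A₀ ⊕ A₁ ⊕ Ac)
      (RegProg (V₀ ⊕ V₁) (A₀ ⊕ A₁ ⊕ Ac) (HavocProg (V₀ ⊕ V₁) (P₀ ⊕ P₁))) :=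
  RegularCalculus (simpleHet Δ₀ Δ₁ Θ).havoc
    (HavocCalculus (simpleHet Δ₀ Δ₁ Θ) (SimpleHetCalculus Δ₀ Δ₁ Θ C₀ C₁))
    {N₀.lift₀ V₁ A₁ Ac, N₁.lift₁ V₀ A₀ Ac}

/-! Everything reduces to one claim: for every program $p$ and every first-order $G$, the formula
$[p]G$ is provably equivalent to a first-order formula. Eliminating modalities from the inside out
then makes any formula $F$ provably equivalent to a first-order $R$. If $F$ is valid, so is $R$;
hence $R$ is among the permitted assumptions, and $F$ is derivable (`Deductive.of_valid`).

For a program $p$ of one of the two theories, the equivalent is $\forall\bar w\,(R\to\forall\bar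
x(\bar x\doteq\bar w\to G))$. Here $\bar x$ covers the variables of $p$, $\bar w$ consists of fresh
twins, and $R$ is the rendition of $\langle p\rangle\,\bar x\doteq\bar w$. The equivalence of $R$
and $\langle p\rangle\,\bar x\doteq\bar w$ is valid in the component theory, so its relatively
complete calculus derives it and the reduction rules import it. The rules G, V, B, K alone lead from
there to $[p]G$, even if $G$ speaks about both theories (`Deductive.box_of_rendition`,
`Embedding.exists_fo_iff_box`). Havoc is a quantifier, and sequence, choice and test are eliminated
by their axioms.

For loops, let $F(v)$ say that some run of exactly $v$ iterations ends in $\neg G$. Gödel codes make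
this first-order: each relevant variable gets a code for its values along the run, and a formula
states that consecutive entries are linked by $p$ (`definable_reach`). All counting is done in the
first theory; codes from the second are indexed through equality of natural numbers across the
theories (`sequenceCoding_fullHet`). Then $\forall v\,\neg F$ is equivalent to $[p^*]G$: one
implication follows from the induction axiom with this formula as invariant, the other from the
convergence axiom with $F$ as variant (`exists_fo_iff_box_star`).

Soundness is checked rule by rule. Embeddings of theories preserve and reflect validity, which
handles the reduction rules; convergence is an induction on the counter. -/

namespace DynTheory

/-! ### Semantics: coincidence, updates of states, soundness of the elementary rules -/

section Semantics

variable {U V A P S : Type*} (Δ : DynTheory U V A P S)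

variable {Δ} in
theorem EqOn.symm {μ ν : S} {X : Set V} (h : Δ.EqOn μ ν X) : Δ.EqOn ν μ X :=
  fun v hv => (h v hv).symm

variable {Δ} in
theorem EqOn.trans {μ ν ω : S} {X : Set V} (h : Δ.EqOn μ ν X) (h' : Δ.EqOn ν ω X) :
    Δ.EqOn μ ω X :=
  fun v hv => (h v hv).trans (h' v hv)

variable {Δ} in
theorem EqOn.mono {μ ν : S} {X Y : Set V} (h : Δ.EqOn μ ν Y) (hXY : X ⊆ Y) : Δ.EqOn μ ν X :=
  fun v hv => h v (hXY hv)

theorem sat_iff_of_eqOn_fvSyn (F : Fml V A P) {μ ν : S} (h : Δ.EqOn μ ν (Δ.fvSyn F)) :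
    Δ.Sat F μ ↔ Δ.Sat F ν :=
  ⟨Δ.coincidence F μ ν h, Δ.coincidence F ν μ h.symm⟩

theorem sat_iff_of_eval_eq (F : Fml V A P) {μ ν : S} (h : ∀ v, Δ.eval μ v = Δ.eval ν v) :
    Δ.Sat F μ ↔ Δ.Sat F ν :=
  Δ.sat_iff_of_eqOn_fvSyn F fun v _ => h v

@[simp] theorem sat_neg (F : Fml V A P) (μ : S) : Δ.Sat (.neg F) μ ↔ ¬ Δ.Sat F μ := Iff.rfl

@[simp] theorem sat_and (F G : Fml V A P) (μ : S) :
    Δ.Sat (.and F G) μ ↔ Δ.Sat F μ ∧ Δ.Sat G μ := Iff.rfl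

@[simp] theorem sat_imp (F G : Fml V A P) (μ : S) :
    Δ.Sat (.imp F G) μ ↔ (Δ.Sat F μ → Δ.Sat G μ) := by
  simp [Fml.imp]

@[simp] theorem sat_iff (F G : Fml V A P) (μ : S) :
    Δ.Sat (.iff F G) μ ↔ (Δ.Sat F μ ↔ Δ.Sat G μ) := by
  simp [Fml.iff, iff_def]

theorem sat_all (v : V) (F : Fml V A P) (μ : S) :
    Δ.Sat (.all v F) μ ↔ ∀ ν, Δ.EqOn μ ν {v}ᶜ → Δ.Sat F ν := Iff.rfl

theorem sat_box (p : P) (F : Fml V A P) (μ : S) :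
    Δ.Sat (.box p F) μ ↔ ∀ ν, Δ.progEval p μ ν → Δ.Sat F ν := Iff.rfl

theorem sat_ex (v : V) (F : Fml V A P) (μ : S) :
    Δ.Sat (.ex v F) μ ↔ ∃ ν, Δ.EqOn μ ν {v}ᶜ ∧ Δ.Sat F ν := by
  simp [Fml.ex, sat_all]

theorem sat_dia (p : P) (F : Fml V A P) (μ : S) :
    Δ.Sat (.dia p F) μ ↔ ∃ ν, Δ.progEval p μ ν ∧ Δ.Sat F ν := by
  simp [Fml.dia, sat_box]

theorem notMem_fvSem {F : Fml V A P} {v : V}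
    (h : ∀ μ ν, Δ.EqOn μ ν {v}ᶜ → Δ.Sat F μ → Δ.Sat F ν) : v ∉ Δ.fvSem F :=
  fun ⟨μ, ν, h1, h2, h3⟩ => h3 (h μ ν h1 h2)

theorem sat_of_notMem_fvSem {F : Fml V A P} {v : V} (h : v ∉ Δ.fvSem F) {μ ν : S}
    (hμν : Δ.EqOn μ ν {v}ᶜ) (hμ : Δ.Sat F μ) : Δ.Sat F ν :=
  by_contra fun hν => h ⟨μ, ν, hμν, hμ, hν⟩

theorem fvSem_subset_fvSyn (F : Fml V A P) : Δ.fvSem F ⊆ Δ.fvSyn F := by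
  rintro v ⟨μ, ν, h1, h2, h3⟩
  by_contra hv
  exact h3 (Δ.coincidence F μ ν (h1.mono fun u hu => by rintro rfl; exact hv hu) h2)

/-- If $v\notin\mathrm{FV}(p)$, the set $X=\{v\}^c$ is admissible in the coincidence property of
$p$, which then yields the very run that semantic freeness of $v$ denies. -/
theorem fvSemProg_subset_fvProg (p : P) : Δ.fvSemProg p ⊆ Δ.fvProg p := by
  rintro v ⟨μ, ν, ω, h1, h2, h3⟩
  by_contra hv
  obtain ⟨κ, h4, h5⟩ := Δ.fvProg_overapprox p μ ν ω {v}ᶜ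
    (fun u hu => by rintro rfl; exact hv hu) h1 h2
  exact h3 ⟨κ, h5, h4⟩

/-- The truth of a formula depends only on its semantically free variables. -/
theorem sat_of_eqOn_fvSem (F : Fml V A P) {μ ν : S} (h : Δ.EqOn μ ν (Δ.fvSem F))
    (hμ : Δ.Sat F μ) : Δ.Sat F ν := by
  -- Non-free variables are changed one at a time, which reaches only finite sets of changes.
  have key : ∀ X : Set V, X.Finite → X ∩ Δ.fvSem F = ∅ → ∀ μ ν, Δ.EqOn μ ν Xᶜ →
      Δ.Sat F μ → Δ.Sat F ν := by
    intro X hX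
    induction X, hX using Set.Finite.induction_on with
    | empty => exact fun _ μ ν h => Δ.coincidence F μ ν fun v _ => h v (by simp)
    | @insert x X hx _ ih =>
      intro hXF μ ν h hμ
      obtain ⟨κ, hκ⟩ := Δ.interpolation ν μ {x}
      have h1 : Δ.Sat F κ := by
        refine Δ.sat_of_notMem_fvSem (v := x) (fun hxF => ?_)
          (fun u hu => ((hκ u).2 hu).symm) hμ
        exact (hXF.subset ⟨Set.mem_insert _ _, hxF⟩)
      refine ih ?_ κ ν (fun u hu => ?_) h1
      · exact Set.subset_empty_iff.1 fun u hu => hXF.subset ⟨Set.mem_insert_of_mem _ hu.1, hu.2⟩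
      · by_cases hux : u = x
        · exact (hκ u).1 hux
        · rw [(hκ u).2 hux]
          exact h u (by simpa [hux] using hu)
  -- The intermediate state agrees with ν on all syntactically free variables, and differs from μ
  -- only on finitely many variables that are not semantically free.
  obtain ⟨κ, hκ⟩ := Δ.interpolation ν μ (Δ.fvSyn F)
  have h1 : Δ.Sat F κ := by
    refine key (Δ.fvSyn F \ Δ.fvSem F) ((Δ.fvSyn_finite F).subset Set.sdiff_subset)
      (by ext; simp +contextual) μ κ (fun u hu => ?_) hμ
    by_cases hu' : u ∈ Δ.fvSyn F
    · rw [(hκ u).1 hu']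
      exact h u (by simpa [hu'] using hu)
    · exact ((hκ u).2 hu').symm
  exact Δ.coincidence F κ ν (fun u hu => (hκ u).1 hu) h1

theorem eval_eq_of_notMem_bvSem {p : P} {v : V} (h : v ∉ Δ.bvSem p) {μ ν : S}
    (hp : Δ.progEval p μ ν) : Δ.eval μ v = Δ.eval ν v :=
  by_contra fun hne => h ⟨μ, ν, hp, hne⟩

theorem eval_mem_valueSet (μ : S) (v : V) : Δ.eval μ v ∈ Δ.valueSet v := ⟨μ, rfl⟩

/-- Finitely many variables can be assigned arbitrary admissible values. -/
theorem exists_update {X : Set V} (hX : X.Finite) (f : V → U) (hf : ∀ v ∈ X, f v ∈ Δ.valueSet v)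
    (μ : S) : ∃ ν, (∀ v ∈ X, Δ.eval ν v = f v) ∧ Δ.EqOn μ ν Xᶜ := by
  induction X, hX using Set.Finite.induction_on with
  | empty => exact ⟨μ, by simp, fun _ _ => rfl⟩
  | @insert x X hx _ ih =>
    obtain ⟨ν, h1, h2⟩ := ih fun v hv => hf v (Set.mem_insert_of_mem _ hv)
    obtain ⟨κ, hκ⟩ := hf x (Set.mem_insert _ _)
    obtain ⟨ω, hω⟩ := Δ.interpolation κ ν {x}
    refine ⟨ω, ?_, fun u hu => ?_⟩
    · rintro v (rfl | hv)
      · rw [(hω v).1 rfl, hκ]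
      · rw [(hω v).2 (by rintro rfl; exact hx hv), h1 v hv]
    · rw [(hω u).2 (by rintro rfl; simp at hu)]
      exact h2 u fun hu' => hu (Set.mem_insert_of_mem _ hu')

theorem exists_update_singleton {v : V} {δ : U} (hδ : δ ∈ Δ.valueSet v) (μ : S) :
    ∃ ν, Δ.eval ν v = δ ∧ Δ.EqOn μ ν {v}ᶜ := by
  obtain ⟨ν, h1, h2⟩ := Δ.exists_update (Set.finite_singleton v) (fun _ => δ) (by simpa) μ
  exact ⟨ν, h1 v rfl, h2⟩

/-- A program can be run from any state that agrees on a set covering its variables. -/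
theorem progEval_transfer {p : P} {X : Set V} (hfv : Δ.fvProg p ⊆ X) {μ ν ω : S}
    (h : Δ.EqOn μ ν X) (hp : Δ.progEval p μ ω) :
    ∃ ω', Δ.progEval p ν ω' ∧ Δ.EqOn ω ω' X :=
  Δ.fvProg_overapprox p μ ν ω X hfv h hp

/-- Since $v$ is not free in $p$, a run can be replayed after any change of $v$; since $v$ is not
bound, both runs keep their values of $v$. So changing $v$ before or after the run leads to states
with the same values. -/
theorem sat_box_all_comm {p : P} {v : V} (hv : v ∉ Δ.varSem p) (F : Fml V A P) (μ : S) :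
    Δ.Sat (.all v (.box p F)) μ ↔ Δ.Sat (.box p (.all v F)) μ := by
  have hbv : v ∉ Δ.bvSem p := fun h => hv (Or.inr h)
  have hfv : ∀ μ μ' ν, Δ.EqOn μ μ' {v}ᶜ → Δ.progEval p μ ν →
      ∃ ν', Δ.EqOn ν ν' {v}ᶜ ∧ Δ.progEval p μ' ν' :=
    fun μ μ' ν h1 h2 => by_contra fun h3 => hv (Or.inl ⟨μ, μ', ν, h1, h2, h3⟩)
  constructor
  · intro h ν hν ν' hν'
    obtain ⟨μ', hμ'⟩ := Δ.interpolation ν' μ {v}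
    have h1 : Δ.EqOn μ μ' {v}ᶜ := fun u hu => ((hμ' u).2 hu).symm
    obtain ⟨ν'', h2, h3⟩ := hfv μ μ' ν h1 hν
    refine (Δ.sat_iff_of_eval_eq F fun u => ?_).1 (h μ' h1 ν'' h3)
    by_cases hu : u = v
    · subst hu
      rw [← Δ.eval_eq_of_notMem_bvSem hbv h3, (hμ' u).1 rfl]
    · rw [← h2 u hu, hν' u hu]
  · intro h μ' hμ' ν hν
    obtain ⟨ν', h2, h3⟩ := hfv μ' μ ν hμ'.symm hν
    exact h ν' h3 ν h2.symm

theorem elementaryRule_sound : Calculus.Sound (ElementaryRule Δ) Δ := by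
  intro L F h hL μ
  cases h with
  | taut F h => exact h (fun G => Δ.Sat G μ) (fun _ => Iff.rfl) fun _ _ => Iff.rfl
  | mp F G =>
    exact (Δ.sat_imp _ _ μ).1 (hL (.imp _ _) (by simp) μ) (hL _ List.mem_cons_self μ)
  | gen v F => exact fun ν _ => hL F (by simp) ν
  | allElim v F => exact (Δ.sat_imp _ _ μ).2 fun h => h μ fun _ _ => rfl
  | allDistrib v F G =>
    simp only [sat_imp, sat_all]
    exact fun h1 h2 ν hν => h1 ν hν (h2 ν hν)
  | allVacuous v F h =>
    exact (Δ.sat_imp _ _ μ).2 fun h1 ν hν => Δ.sat_of_notMem_fvSem h hν h1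
  | G p F => exact fun ν _ => hL F (by simp) ν
  | V p F h =>
    refine (Δ.sat_imp _ _ μ).2 fun h1 ν hν => Δ.sat_of_eqOn_fvSem F (fun v hv => ?_) h1
    exact Δ.eval_eq_of_notMem_bvSem (fun hb => h.subset ⟨hv, hb⟩) hν
  | B p v F h => exact (Δ.sat_iff _ _ μ).2 (Δ.sat_box_all_comm h F μ)
  | K p F G =>
    simp only [sat_imp, sat_box]
    exact fun h1 h2 ν hν => h1 ν hν (h2 ν hν)

end Semantics

/-! ### Definable sets of states -/

section Definable

variable {U V A P S : Type*} (Δ : DynTheory U V A P S)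

/-- The state predicate `Q` is expressed by a first-order formula. -/
def Definable (Q : S → Prop) : Prop := ∃ F : FOFml V A, ∀ μ, Δ.SatFO F μ ↔ Q μ

variable {Δ}

theorem definable_satFO (F : FOFml V A) : Δ.Definable (Δ.SatFO F) := ⟨F, fun _ => Iff.rfl⟩

theorem Definable.congr {Q Q' : S → Prop} (h : Δ.Definable Q) (hQ : ∀ μ, Q μ ↔ Q' μ) :
    Δ.Definable Q' :=
  h.imp fun _ hF μ => (hF μ).trans (hQ μ)

theorem Definable.not {Q : S → Prop} (h : Δ.Definable Q) : Δ.Definable fun μ => ¬ Q μ :=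
  let ⟨F, hF⟩ := h
  ⟨.neg F, fun μ => not_congr (hF μ)⟩

theorem Definable.and {Q Q' : S → Prop} (h : Δ.Definable Q) (h' : Δ.Definable Q') :
    Δ.Definable fun μ => Q μ ∧ Q' μ :=
  let ⟨F, hF⟩ := h
  let ⟨F', hF'⟩ := h'
  ⟨.and F F', fun μ => and_congr (hF μ) (hF' μ)⟩

theorem Definable.imp {Q Q' : S → Prop} (h : Δ.Definable Q) (h' : Δ.Definable Q') :
    Δ.Definable fun μ => Q μ → Q' μ :=
  (h.and h'.not).not.congr fun μ => by tauto

theorem Definable.all_one {Q : S → Prop} (h : Δ.Definable Q) (v : V) :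
    Δ.Definable fun μ => ∀ ν, Δ.EqOn μ ν {v}ᶜ → Q ν :=
  let ⟨F, hF⟩ := h
  ⟨.all v F, fun _ => forall₂_congr fun ν _ => hF ν⟩

theorem Definable.ext {Q : S → Prop} (h : Δ.Definable Q) {μ ν : S}
    (hμν : ∀ v, Δ.eval μ v = Δ.eval ν v) (hμ : Q μ) : Q ν := by
  obtain ⟨F, hF⟩ := h
  exact (hF ν).1 ((Δ.sat_iff_of_eval_eq _ hμν).1 ((hF μ).2 hμ))

/-- Interpolation supplies the intermediate state in which only $x$ has changed. This turns iterated
quantifiers into quantification over all changes on a finite set. -/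
theorem forall_eqOn_insert (x : V) (X : Set V) (Q : S → Prop) (μ : S) :
    (∀ ν, Δ.EqOn μ ν {x}ᶜ → ∀ ω, Δ.EqOn ν ω Xᶜ → Q ω) ↔
      ∀ ν, Δ.EqOn μ ν (insert x X)ᶜ → Q ν := by
  constructor
  · intro h ν hν
    obtain ⟨κ, hκ⟩ := Δ.interpolation ν μ {x}
    refine h κ (fun u hu => ((hκ u).2 hu).symm) ν fun u hu => ?_
    by_cases hux : u = x
    · exact (hκ u).1 hux
    · rw [(hκ u).2 hux]
      exact hν u (by simpa [hux] using hu)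
  · intro h ν hν ω hω
    refine h ω fun u hu => ?_
    simp only [Set.mem_compl_iff, Set.mem_insert_iff, not_or] at hu
    rw [hν u hu.1, hω u hu.2]

theorem Definable.all {Q : S → Prop} (h : Δ.Definable Q) {X : Set V} (hX : X.Finite) :
    Δ.Definable fun μ => ∀ ν, Δ.EqOn μ ν Xᶜ → Q ν := by
  induction X, hX using Set.Finite.induction_on with
  | empty =>
    exact h.congr fun μ => ⟨fun hμ ν hν => h.ext (fun v => hν v (by simp)) hμ,
      fun hμ => hμ μ fun _ _ => rfl⟩
  | @insert x X _ _ ih => exact (ih.all_one x).congr fun μ => forall_eqOn_insert x X Q μ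

theorem Definable.ex {Q : S → Prop} (h : Δ.Definable Q) {X : Set V} (hX : X.Finite) :
    Δ.Definable fun μ => ∃ ν, Δ.EqOn μ ν Xᶜ ∧ Q ν :=
  (h.not.all hX).not.congr fun μ => by push Not; rfl

theorem Definable.forall_mem {ι : Type*} {X : Set ι} (hX : X.Finite) (hne : X.Nonempty)
    {Q : ι → S → Prop} (h : ∀ i ∈ X, Δ.Definable (Q i)) :
    Δ.Definable fun μ => ∀ i ∈ X, Q i μ := by
  obtain ⟨i₀, hi₀⟩ := hne
  -- There is no primitive formula for truth; a trivial implication built from one conjunct serves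
  -- as the empty conjunction.
  have htrue : Δ.Definable fun _ => True :=
    ((h i₀ hi₀).imp (h i₀ hi₀)).congr fun _ => by tauto
  clear hi₀
  induction X, hX using Set.Finite.induction_on with
  | empty => exact htrue.congr fun μ => by simp
  | @insert x X _ _ ih =>
    exact ((h x (Set.mem_insert _ _)).and
      (ih fun i hi => h i (Set.mem_insert_of_mem _ hi))).congr fun μ => by simp

end Definable

end DynTheory

/-- Distinct fresh elements can be chosen from finitely many infinite sets. -/
theorem Set.Finite.exists_injOn_fresh {α ι : Type*} {X : Set ι} (hX : X.Finite) {W : ι → Set α}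
    (hW : ∀ x ∈ X, (W x).Infinite) {B : Set α} (hB : B.Finite) [Nonempty α] :
    ∃ f : ι → α, Set.InjOn f X ∧ ∀ x ∈ X, f x ∈ W x ∧ f x ∉ B := by
  classical
  induction X, hX using Set.Finite.induction_on with
  | empty => exact ⟨fun _ => Classical.arbitrary α, by simp, by simp⟩
  | @insert x X hx hXfin ih =>
    obtain ⟨f, h1, h2⟩ := ih fun y hy => hW y (Set.mem_insert_of_mem _ hy)
    obtain ⟨a, ha, ha'⟩ := (hW x (Set.mem_insert _ _)).exists_notMem_finite
      (hB.union (hXfin.image f))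
    have hfa : ∀ y ∈ X, Function.update f x a y = f y := fun y hy =>
      Function.update_of_ne (by rintro rfl; exact hx hy) _ _
    refine ⟨Function.update f x a, ?_, ?_⟩
    · rw [Set.injOn_insert hx]
      refine ⟨h1.congr fun y hy => (hfa y hy).symm, ?_⟩
      rw [Function.update_self]
      rintro ⟨y, hy, hya⟩
      exact ha' (Or.inr ⟨y, hy, by rw [← hfa y hy, hya]⟩)
    · rintro y (rfl | hy)
      · rw [Function.update_self]
        exact ⟨ha, fun h => ha' (Or.inl h)⟩
      · rw [hfa y hy]
        exact h2 y hy

namespace DynTheory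

/-! ### Runs of bounded length are definable -/

section Reach

variable {U V A P S : Type*} (Δ : DynTheory U V A P S)

/-- Some run of `p` of length `k` ends in a state that satisfies `Q`. -/
def Reach (p : P) (Q : S → Prop) : ℕ → S → Prop
  | 0, μ => Q μ
  | k + 1, μ => ∃ ν, Δ.progEval p μ ν ∧ Reach p Q k ν

variable {Δ}

/-- Agreement on $X$ survives each step by the coincidence property of $p$, and $Q$ sees nothing
outside $X$. -/
theorem Reach.transfer {p : P} {Q : S → Prop} {X : Set V} (hfv : Δ.fvProg p ⊆ X)
    (hQ : ∀ μ ν, Δ.EqOn μ ν X → Q μ → Q ν) {k : ℕ} {μ ν : S} (h : Δ.EqOn μ ν X)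
    (hμ : Δ.Reach p Q k μ) : Δ.Reach p Q k ν := by
  induction k generalizing μ ν with
  | zero => exact hQ μ ν h hμ
  | succ k ih =>
    obtain ⟨ω, h1, h2⟩ := hμ
    obtain ⟨ω', h3, h4⟩ := Δ.progEval_transfer hfv h h1
    exact ⟨ω', h3, ih h4 h2⟩

theorem Reach.exists_run {p : P} {Q : S → Prop} {k : ℕ} {μ : S} (h : Δ.Reach p Q k μ) :
    ∃ s : ℕ → S, s 0 = μ ∧ (∀ i < k, Δ.progEval p (s i) (s (i + 1))) ∧ Q (s k) := by
  induction k generalizing μ with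
  | zero => exact ⟨fun _ => μ, rfl, by simp, h⟩
  | succ k ih =>
    obtain ⟨ν, h1, h2⟩ := h
    obtain ⟨s, h3, h4, h5⟩ := ih h2
    refine ⟨fun i => i.casesOn μ s, rfl, fun i hi => ?_, h5⟩
    cases i with
    | zero => simpa [h3] using h1
    | succ i => exact h4 i (by omega)

variable (Δ) in
/-- Finite sequences of values of `v` have codes; `G w n j` says that the component with index `j`
of the sequence of length `n` that `w` encodes is the value of `v`, for `w` from an infinite set. -/
def SequenceCoding (N : NatData U V A) (v : V) : Prop :=
  ∃ (W : Set V) (G : V → N.VN → N.VN → FOFml V A), W.Infinite ∧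
    ∀ (K : ℕ) (δ : Fin K → U), (∀ k, δ k ∈ Δ.valueSet v) →
      ∃ ε, ∀ w ∈ W, ε ∈ Δ.valueSet w ∧ ∀ (n j : N.VN) μ, Δ.eval μ w = ε →
        N.toNat (Δ.eval μ n) = K →
          (Δ.SatFO (G w n j) μ ↔
            ∃ k : Fin K, N.toNat (Δ.eval μ j) = (k : ℕ) + 1 ∧ Δ.eval μ v = δ k)

theorem InductivelyExpressive.exists_value {N : NatData U V A}
    (hN : Δ.InductivelyExpressive N) (v : N.VN) (n : ℕ) (μ : S) :
    ∃ ν, Δ.EqOn μ ν {(v : V)}ᶜ ∧ N.toNat (Δ.eval ν v) = n := by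
  obtain ⟨κ, hκ⟩ := hN.integer_expressive v v.2 n
  obtain ⟨ν, h1, h2⟩ := Δ.exists_update_singleton (Δ.eval_mem_valueSet κ v) μ
  exact ⟨ν, h2, by rw [h1, hκ]⟩

/-- No numerals are available; one is the successor of a number that is not positive, held in an
auxiliary variable. -/
theorem InductivelyExpressive.definable_eq_one {N : NatData U V A}
    (hN : Δ.InductivelyExpressive N) {i j : N.VN} (hij : i ≠ j) :
    Δ.Definable fun μ => N.toNat (Δ.eval μ j) = 1 := by
  refine (((definable_satFO (N.pos i)).not.and (definable_satFO (N.succ i j))).ex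
    (Set.finite_singleton (i : V))).congr fun μ => ?_
  have hji : (j : V) ∈ ({(i : V)}ᶜ : Set V) := fun h => hij (Subtype.ext h.symm)
  constructor
  · rintro ⟨ν, h1, h2, h3⟩
    rw [hN.pos_sound] at h2
    rw [hN.succ_sound i j hij] at h3
    rw [h1 j hji]
    omega
  · intro h
    obtain ⟨ν, h1, h2⟩ := hN.exists_value i 0 μ
    refine ⟨ν, h1, ?_, ?_⟩
    · rw [hN.pos_sound]
      omega
    · rw [hN.succ_sound i j hij, ← h1 j hji]
      omega

/-- The matrix of the formula that describes a run: whatever the codes describe at index `j` is a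
state which satisfies `Q` if `j` is the last index, and otherwise has a `p`-successor described by
the codes at the next index. -/
def RunStep (Δ : DynTheory U V A P S) (N : NatData U V A) (p : P) (Q Γ : S → Prop)
    (n j i : N.VN) (μ : S) : Prop :=
  Γ μ → (N.toNat (Δ.eval μ j) = N.toNat (Δ.eval μ n) → Q μ) ∧
    (N.toNat (Δ.eval μ j) ≠ N.toNat (Δ.eval μ n) →
      ∃ ν, Δ.EqOn μ ν {(i : V)}ᶜ ∧ N.toNat (Δ.eval ν j) + 1 = N.toNat (Δ.eval ν i) ∧
        ∃ ω, Δ.EqOn ν ω {(j : V)}ᶜ ∧ N.toNat (Δ.eval ω j) = N.toNat (Δ.eval ω i) ∧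
          ∃ κ, Δ.progEval p ω κ ∧ Γ κ)

/-- The hypothesis on $p$ is needed only for the postcondition `Γ`: the next state is described by
the same formula as the current one, so a single formula serves runs of every length. -/
theorem definable_runStep {N : NatData U V A} (hN : Δ.InductivelyExpressive N) {p : P}
    (hp : ∀ Q, Δ.Definable Q → Δ.Definable fun μ => ∃ ν, Δ.progEval p μ ν ∧ Q ν)
    {Q Γ : S → Prop} (hQ : Δ.Definable Q) (hΓ : Δ.Definable Γ) {n j i : N.VN} (hnj : n ≠ j)
    (hij : i ≠ j) : Δ.Definable (RunStep Δ N p Q Γ n j i) := by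
  have hjn : Δ.Definable fun μ => N.toNat (Δ.eval μ j) = N.toNat (Δ.eval μ n) :=
    (definable_satFO _).congr (hN.eq_sound j n hnj.symm)
  have hji : Δ.Definable fun μ => N.toNat (Δ.eval μ j) = N.toNat (Δ.eval μ i) :=
    (definable_satFO _).congr (hN.eq_sound j i hij.symm)
  have hsucc : Δ.Definable fun μ => N.toNat (Δ.eval μ j) + 1 = N.toNat (Δ.eval μ i) :=
    (definable_satFO _).congr (hN.succ_sound j i hij.symm)
  exact hΓ.imp ((hjn.imp hQ).and (hjn.not.imp ((hsucc.and
    ((hji.and (hp Γ hΓ)).ex (Set.finite_singleton _))).ex (Set.finite_singleton _))))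

/-- Induction on the number of remaining steps. The codes need not come from a genuine run: whenever
`Γ` accepts the current state, `RunStep` supplies a successor that `Γ` accepts at the next index. As
`hμ` covers all states that differ from μ only on $X$ and the two counters, it stays applicable
along the way. -/
theorem reach_of_runStep {N : NatData U V A} {p : P} {X : Set V} (hfv : Δ.fvProg p ⊆ X)
    (hbv : Δ.bvSem p ⊆ X) {Q Γ : S → Prop} (hQ : ∀ μ ν, Δ.EqOn μ ν X → Q μ → Q ν)
    {n j i : N.VN} (hnX : (n : V) ∉ X) (hjX : (j : V) ∉ X) (hiX : (i : V) ∉ X)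
    (hnj : n ≠ j) (hni : n ≠ i) (hij : i ≠ j) {μ : S}
    (hμ : ∀ ν, Δ.EqOn μ ν (X ∪ {(j : V), (i : V)})ᶜ → RunStep Δ N p Q Γ n j i ν) (k : ℕ) :
    ∀ ν, Δ.EqOn μ ν (X ∪ {(j : V), (i : V)})ᶜ → Γ ν →
      N.toNat (Δ.eval ν j) + k = N.toNat (Δ.eval ν n) → Δ.Reach p Q k ν := by
  have hne : ∀ {a b : N.VN}, a ≠ b → (a : V) ≠ b := fun h h' => h (Subtype.ext h')
  induction k with
  | zero => exact fun ν hν hΓ hk => (hμ ν hν hΓ).1 hk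
  | succ k ih =>
    intro ν hν hΓ hk
    obtain ⟨ν₁, h1, h2, ω, h3, h4, κ, h5, h6⟩ := (hμ ν hν hΓ).2 (by omega)
    have hνω : Δ.EqOn ν ω {(j : V), (i : V)}ᶜ := fun u hu => by
      simp only [Set.mem_compl_iff, Set.mem_insert_iff, Set.mem_singleton_iff, not_or] at hu
      rw [h1 u hu.2, h3 u hu.1]
    have hωκ : ∀ u ∉ X, Δ.eval ω u = Δ.eval κ u := fun u hu =>
      Δ.eval_eq_of_notMem_bvSem (fun h => hu (hbv h)) h5
    have hκ : Δ.Reach p Q k κ := by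
      refine ih κ (fun u hu => ?_) h6 ?_
      · simp only [Set.mem_compl_iff, Set.mem_union, not_or] at hu
        rw [hν u fun h => h.elim hu.1 hu.2, hνω u hu.2, hωκ u hu.1]
      · have e1 : Δ.eval ν n = Δ.eval κ n := by
          rw [hνω n (by simp [hne hnj, hne hni]), hωκ n hnX]
        have e2 : Δ.eval ν j = Δ.eval ν₁ j := h1 j (hne hij.symm)
        have e3 : Δ.eval ν₁ i = Δ.eval ω i := h3 i (hne hij)
        rw [← hωκ j hjX, ← e1, h4, ← e3, ← h2, ← e2]
        omega
    have hων : Δ.EqOn ω ν X := fun u hu => (hνω u (by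
      simp only [Set.mem_compl_iff, Set.mem_insert_iff, Set.mem_singleton_iff, not_or]
      exact ⟨fun h => hjX (h ▸ hu), fun h => hiX (h ▸ hu)⟩)).symm
    exact Reach.transfer hfv hQ (k := k + 1) hων ⟨κ, h5, hκ⟩

/-- Here `Γ` identifies the current state, on $X$, with the entry `s l` of the run, where the index
is `l + 1`. The step to `s (l + 1)` is replayed after both counters have been moved to `l + 2`, the
index of the new entry when counting from 1. -/
theorem runStep_of_run {N : NatData U V A} (hN : Δ.InductivelyExpressive N) {p : P} {X : Set V}
    (hfv : Δ.fvProg p ⊆ X) (hbv : Δ.bvSem p ⊆ X) {Q Γ : S → Prop}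
    (hQ : ∀ μ ν, Δ.EqOn μ ν X → Q μ → Q ν) {n j i : N.VN} (hnX : (n : V) ∉ X)
    (hjX : (j : V) ∉ X) (hiX : (i : V) ∉ X) (hnj : n ≠ j) (hni : n ≠ i) (hij : i ≠ j)
    {s : ℕ → S} {k : ℕ} (hs : ∀ i < k, Δ.progEval p (s i) (s (i + 1))) (hsk : Q (s k)) {μ : S}
    (hn : N.toNat (Δ.eval μ n) = k + 1)
    (hΓ : ∀ ν, Δ.EqOn μ ν (X ∪ {(j : V), (i : V)})ᶜ →
      (Γ ν ↔ ∃ l ≤ k, N.toNat (Δ.eval ν j) = l + 1 ∧ Δ.EqOn ν (s l) X)) :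
    ∀ ν, Δ.EqOn μ ν (X ∪ {(j : V), (i : V)})ᶜ → RunStep Δ N p Q Γ n j i ν := by
  have hne : ∀ {a b : N.VN}, a ≠ b → (a : V) ≠ b := fun h h' => h (Subtype.ext h')
  intro ν hν hΓν
  obtain ⟨l, hl, h1, h2⟩ := (hΓ ν hν).1 hΓν
  have hνn : N.toNat (Δ.eval ν n) = k + 1 := by
    rw [← hν n (by simp [hnX, hne hnj, hne hni]), hn]
  constructor
  · intro h
    obtain rfl : l = k := by omega
    exact hQ _ _ h2.symm hsk
  · intro h
    obtain ⟨ν₁, h3, h4⟩ := hN.exists_value i (l + 2) ν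
    obtain ⟨ω, h5, h6⟩ := hN.exists_value j (l + 2) ν₁
    have hνω : Δ.EqOn ν ω {(j : V), (i : V)}ᶜ := fun u hu => by
      simp only [Set.mem_compl_iff, Set.mem_insert_iff, Set.mem_singleton_iff, not_or] at hu
      rw [h3 u hu.2, h5 u hu.1]
    have hsω : Δ.EqOn (s l) ω X := h2.symm.trans fun u hu => hνω u (by
      simp only [Set.mem_compl_iff, Set.mem_insert_iff, Set.mem_singleton_iff, not_or]
      exact ⟨fun h => hjX (h ▸ hu), fun h => hiX (h ▸ hu)⟩)
    obtain ⟨κ, h7, h8⟩ := Δ.progEval_transfer hfv hsω (hs l (by omega))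
    have hωκ : ∀ u ∉ X, Δ.eval ω u = Δ.eval κ u := fun u hu =>
      Δ.eval_eq_of_notMem_bvSem (fun h => hu (hbv h)) h7
    refine ⟨ν₁, h3, ?_, ω, h5, ?_, κ, h7, ?_⟩
    · rw [← h3 j (hne hij.symm), h1, h4]
    · rw [h6, ← h5 i (hne hij), h4]
    · refine (hΓ κ fun u hu => ?_).2 ⟨l + 1, by omega, ?_, h8.symm⟩
      · simp only [Set.mem_compl_iff, Set.mem_union, not_or] at hu
        rw [hν u fun h => h.elim hu.1 hu.2, hνω u hu.2, hωκ u hu.1]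
      · rw [← hωκ j hjX, h6]

/-- If the modality of `p` preserves definability, then the existence of a run of `p` whose length
is the value of a counting variable is definable. -/
theorem definable_reach {N : NatData U V A} (hN : Δ.InductivelyExpressive N)
    (hinf : N.VN.Infinite) (hcode : ∀ v, Δ.SequenceCoding N v) {p : P}
    (hp : ∀ Q, Δ.Definable Q → Δ.Definable fun μ => ∃ ν, Δ.progEval p μ ν ∧ Q ν)
    (hbv : (Δ.bvSem p).Finite) (F : FOFml V A) (v : N.VN) :
    Δ.Definable fun μ => Δ.Reach p (Δ.SatFO F) (N.toNat (Δ.eval μ v)) μ := by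
  have hne : ∀ {a b : N.VN}, a ≠ b → (a : V) ≠ b := fun h h' => h (Subtype.ext h')
  -- Including $v$ makes $X$ nonempty: the conjunction over $X$ requires this, and the position in
  -- the run is later read off from the entry for $v$.
  set X : Set V := insert (v : V) (Δ.fvProg p ∪ Δ.bvSem p ∪ Δ.fvSyn (F.toFml P))
  have hX : X.Finite :=
    (((Δ.fvProg_finite p).union hbv).union (Δ.fvSyn_finite _)).insert _
  have hvX : (v : V) ∈ X := Set.mem_insert _ _
  have hfvX : Δ.fvProg p ⊆ X := fun u hu => Or.inr (Or.inl (Or.inl hu))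
  have hbvX : Δ.bvSem p ⊆ X := fun u hu => Or.inr (Or.inl (Or.inr hu))
  have hQ : ∀ μ ν, Δ.EqOn μ ν X → Δ.SatFO F μ → Δ.SatFO F ν := fun μ ν h =>
    Δ.coincidence _ μ ν (h.mono fun u hu => Or.inr (Or.inr hu))
  obtain ⟨n', hn'VN, hn'X⟩ := hinf.exists_notMem_finite hX
  obtain ⟨j', hj'VN, hj'X⟩ := hinf.exists_notMem_finite (hX.insert n')
  obtain ⟨i', hi'VN, hi'X⟩ := hinf.exists_notMem_finite ((hX.insert n').insert j')
  obtain ⟨n, rfl⟩ : ∃ n : N.VN, (n : V) = n' := ⟨⟨n', hn'VN⟩, rfl⟩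
  obtain ⟨j, rfl⟩ : ∃ n : N.VN, (n : V) = j' := ⟨⟨j', hj'VN⟩, rfl⟩
  obtain ⟨i, rfl⟩ : ∃ n : N.VN, (n : V) = i' := ⟨⟨i', hi'VN⟩, rfl⟩
  simp only [Set.mem_insert_iff, not_or] at hj'X hi'X
  have hnj : n ≠ j := fun h => hj'X.1 (h ▸ rfl)
  have hni : n ≠ i := fun h => hi'X.2.1 (h ▸ rfl)
  have hij : i ≠ j := fun h => hi'X.1 (h ▸ rfl)
  have hnX := hn'X
  have hjX := hj'X.2
  have hiX := hi'X.2.2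
  have hvn : v ≠ n := fun h => hnX (h ▸ hvX)
  choose W G hW hG using hcode
  have : Nonempty V := ⟨v⟩
  -- Every $x\in X$ gets its own code variable `c x`, outside $X$ and distinct from the counters, so
  -- running $p$ leaves the codes intact.
  obtain ⟨c, hcinj, hc⟩ := hX.exists_injOn_fresh (fun x _ => hW x)
    (hX.union (Set.toFinite {(n : V), (j : V), (i : V)}))
  have hcX : ∀ x ∈ X, c x ∉ X := fun x hx h => (hc x hx).2 (Or.inl h)
  have hcn : ∀ x ∈ X, c x ≠ n := fun x hx h => (hc x hx).2 (Or.inr (by simp [h]))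
  have hcj : ∀ x ∈ X, c x ≠ j := fun x hx h => (hc x hx).2 (Or.inr (by simp [h]))
  have hci : ∀ x ∈ X, c x ≠ i := fun x hx h => (hc x hx).2 (Or.inr (by simp [h]))
  set Γ : S → Prop := fun μ => ∀ x ∈ X, Δ.SatFO (G x (c x) n j) μ
  have hΓ : Δ.Definable Γ := Definable.forall_mem hX ⟨v, hvX⟩ fun x _ => definable_satFO _
  have hdef := ((((hN.definable_eq_one hij).and hΓ).ex (Set.finite_singleton (j : V))).and
    ((definable_runStep hN hp (definable_satFO F) hΓ hnj hij).all
      (hX.union (Set.toFinite {(j : V), (i : V)})))).ex (hX.image c)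
  -- A run of $k$ steps has $k+1$ states, so the code length is $v+1$. It is stored in the fresh
  -- variable $n$ because $p$ may change $v$.
  refine (((definable_satFO (N.succ v n)).and hdef).ex (Set.finite_singleton (n : V))).congr
    fun μ => ?_
  constructor
  · rintro ⟨μ₁, h1, h2, ν, h3, ⟨ω, h4, h5, h6⟩, h7⟩
    rw [hN.succ_sound v n hvn, ← h1 v (hne hvn)] at h2
    have hνn : Δ.eval μ₁ n = Δ.eval ω n := by
      rw [h3 n (by rintro ⟨x, hx, hxn⟩; exact hcn x hx hxn), h4 n (hne hnj)]
    have hω := reach_of_runStep hfvX hbvX hQ hnX hjX hiX hnj hni hij h7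
      (N.toNat (Δ.eval μ v)) ω
      (h4.mono fun u hu => by
        simp only [Set.mem_compl_iff, Set.mem_union, Set.mem_insert_iff, not_or] at hu
        exact hu.2.1) h6
      (by rw [h5, ← hνn, ← h2, add_comm])
    refine Reach.transfer hfvX hQ (fun u hu => ?_) hω
    rw [h1 u (by rintro rfl; exact hnX hu),
      h3 u (by rintro ⟨x, hx, rfl⟩; exact hcX x hx hu), h4 u (by rintro rfl; exact hjX hu)]
  · intro h
    obtain ⟨s, hs0, hs, hsk⟩ := h.exists_run
    set k := N.toNat (Δ.eval μ v)
    obtain ⟨μ₁, h1, h2⟩ := hN.exists_value n (k + 1) μ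
    -- For each variable separately, its values along the run form a sequence of length $k+1$.
    have hε := fun x => hG x (k + 1) (fun l => Δ.eval (s l) x) fun l => Δ.eval_mem_valueSet _ _
    choose ε hε using hε
    obtain ⟨ν, h3, h4⟩ := Δ.exists_update (hX.image c) (fun u => ε (Function.invFunOn c X u))
      (by
        rintro _ ⟨x, hx, rfl⟩
        rw [hcinj.leftInvOn_invFunOn hx]
        exact (hε x (c x) (hc x hx).1).1) μ₁
    have h3' : ∀ x ∈ X, Δ.eval ν (c x) = ε x := fun x hx => by
      rw [h3 _ ⟨x, hx, rfl⟩, hcinj.leftInvOn_invFunOn hx]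
    have hνn : N.toNat (Δ.eval ν n) = k + 1 := by
      rw [← h4 n (by rintro ⟨x, hx, hxn⟩; exact hcn x hx hxn), h2]
    have hΓν : ∀ ω, Δ.EqOn ν ω (X ∪ {(j : V), (i : V)})ᶜ →
        (Γ ω ↔ ∃ l ≤ k, N.toNat (Δ.eval ω j) = l + 1 ∧ Δ.EqOn ω (s l) X) := by
      intro ω hω
      have hx : ∀ x ∈ X, (Δ.SatFO (G x (c x) n j) ω ↔
          ∃ l : Fin (k + 1), N.toNat (Δ.eval ω j) = (l : ℕ) + 1 ∧
            Δ.eval ω x = Δ.eval (s l) x) := fun x hx => by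
        refine (hε x (c x) (hc x hx).1).2 n j ω ?_ ?_
        · rw [← hω _ (by simp [hcX x hx, hcj x hx, hci x hx]), h3' x hx]
        · rw [← hω _ (by simp [hnX, hne hnj, hne hni]), hνn]
      constructor
      · intro hΓω
        obtain ⟨l, hl, -⟩ := (hx v hvX).1 (hΓω v hvX)
        refine ⟨l, by omega, hl, fun x hxX => ?_⟩
        obtain ⟨l', hl', he⟩ := (hx x hxX).1 (hΓω x hxX)
        -- The counter $j$ fixes the position, so the entries for different variables belong to the
        -- same state of the run.
        rwa [show (l : ℕ) = l' by omega]
      · rintro ⟨l, hl, hlj, he⟩ x hxX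
        exact (hx x hxX).2 ⟨⟨l, by omega⟩, hlj, he x hxX⟩
    obtain ⟨ω, h5, h6⟩ := hN.exists_value j 1 ν
    refine ⟨μ₁, h1, ?_, ν, h4, ⟨ω, h5, h6, ?_⟩, runStep_of_run hN hfvX hbvX hQ hnX hjX hiX hnj
      hni hij hs hsk hνn hΓν⟩
    · rw [hN.succ_sound v n hvn, ← h1 v (hne hvn), h2]
    · refine (hΓν ω (h5.mono fun u hu => ?_)).2 ⟨0, by omega, by simpa using h6, fun u hu => ?_⟩
      · simp only [Set.mem_compl_iff, Set.mem_union, Set.mem_insert_iff, not_or] at hu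
        exact hu.2.1
      · rw [hs0, h1 u (by rintro rfl; exact hnX hu),
          h4 u (by rintro ⟨x, hx, rfl⟩; exact hcX x hx hu), h5 u (by rintro rfl; exact hjX hu)]

end Reach

end DynTheory

/-! ### Renaming of symbols -/

theorem FOFml.toFml_map {V A V' A' P P' : Type*} (f : V → V') (g : A → A') (h : P → P')
    (F : FOFml V A) : (F.toFml P).map f g h = FOFml.toFml P' (Fml.map f g id F) := by
  simp only [FOFml.toFml]
  induction F with
  | atom a => rfl
  | neg F ih => simp only [Fml.map, ih]
  | and F G ihF ihG => simp only [Fml.map, ihF, ihG]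
  | all v F ih => simp only [Fml.map, ih, id]
  | box p F _ => exact p.elim

theorem FOFml.toFml_map_id {V A P P' : Type*} (h : P → P') (F : FOFml V A) :
    (F.toFml P).map id id h = F.toFml P' := by
  simp only [FOFml.toFml]
  induction F with
  | atom a => rfl
  | neg F ih => simp only [Fml.map, ih]
  | and F G ihF ihG => simp only [Fml.map, ihF, ihG]
  | all v F ih => simp only [Fml.map, ih, id]
  | box p F _ => exact p.elim

theorem Fml.map_map {V A P V' A' P' V'' A'' P'' : Type*} (f : V → V') (g : A → A') (h : P → P')
    (f' : V' → V'') (g' : A' → A'') (h' : P' → P'') (F : Fml V A P) :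
    (F.map f g h).map f' g' h' = F.map (f' ∘ f) (g' ∘ g) (h' ∘ h) := by
  induction F with
  | atom a => rfl
  | neg F ih => simp only [Fml.map, ih]
  | and F G ihF ihG => simp only [Fml.map, ihF, ihG]
  | all v F ih => simp only [Fml.map, ih, Function.comp]
  | box p F ih => simp only [Fml.map, ih, Function.comp]

namespace DynTheory

/-! ### Embeddings of dynamic theories -/

section Embedding

variable {V'' A'' P'' S'' V' A' P' S' U V A P S : Type*}

/-- The theory `Δ'` is a part of `Δ`: its symbols are interpreted in a projection of the states of
`Δ`, and its programs change no other variables. -/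
structure Embedding (Δ' : DynTheory U V' A' P' S') (Δ : DynTheory U V A P S) where
  onVar : V' → V
  onAtom : A' → A
  onProg : P' → P
  proj : S → S'
  onVar_injective : Function.Injective onVar
  eval_proj : ∀ μ v, Δ.eval μ (onVar v) = Δ'.eval (proj μ) v
  atom_proj : ∀ μ a, μ ∈ Δ.atomEval (onAtom a) ↔ proj μ ∈ Δ'.atomEval a
  prog_proj : ∀ {μ ν p}, Δ.progEval (onProg p) μ ν → Δ'.progEval p (proj μ) (proj ν)
  prog_unchanged : ∀ {μ ν p}, Δ.progEval (onProg p) μ ν → Δ.EqOn μ ν (Set.range onVar)ᶜ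
  prog_lift : ∀ {μ ν' p}, Δ'.progEval p (proj μ) ν' →
    ∃ ν, Δ.progEval (onProg p) μ ν ∧ proj ν = ν'
  state_lift : ∀ μ ν', ∃ ν, proj ν = ν' ∧ Δ.EqOn μ ν (Set.range onVar)ᶜ

namespace Embedding

variable {Δ'' : DynTheory U V'' A'' P'' S''} {Δ' : DynTheory U V' A' P' S'}
  {Δ : DynTheory U V A P S} (e : Embedding Δ' Δ)

def onFml (F : Fml V' A' P') : Fml V A P := F.map e.onVar e.onAtom e.onProg

/-- The translation of first-order formulas. -/
def onFO (F : FOFml V' A') : FOFml V A := Fml.map e.onVar e.onAtom id F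

theorem onFml_toFml (F : FOFml V' A') : e.onFml (F.toFml P') = (e.onFO F).toFml P :=
  F.toFml_map _ _ _

/-- The projection behaves like a bisimulation: runs are matched by `prog_proj` and `prog_lift`, and
changes of a variable by `state_lift`. -/
theorem sat_onFml (F : Fml V' A' P') : ∀ μ, Δ.Sat (e.onFml F) μ ↔ Δ'.Sat F (e.proj μ) := by
  induction F with
  | atom a => exact fun μ => e.atom_proj μ a
  | neg F ih => exact fun μ => not_congr (ih μ)
  | and F G ihF ihG => exact fun μ => and_congr (ihF μ) (ihG μ)
  | all v F ih =>
    intro μ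
    constructor
    · intro h ν' hν'
      obtain ⟨ν, rfl, h2⟩ := e.state_lift μ ν'
      refine (ih ν).1 (h ν fun u hu => ?_)
      by_cases hu' : u ∈ Set.range e.onVar
      · obtain ⟨u, rfl⟩ := hu'
        rw [e.eval_proj, e.eval_proj]
        exact hν' u fun h => hu (congrArg e.onVar h)
      · exact h2 u hu'
    · intro h ν hν
      refine (ih ν).2 (h _ fun u hu => ?_)
      rw [← e.eval_proj, ← e.eval_proj]
      exact hν _ fun h => hu (e.onVar_injective h)
  | box p F ih =>
    intro μ
    constructor
    · intro h ν' hν'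
      obtain ⟨ν, h1, rfl⟩ := e.prog_lift hν'
      exact (ih ν).1 (h ν h1)
    · exact fun h ν hν => (ih ν).2 (h _ (e.prog_proj hν))

theorem satFO_onFO (F : FOFml V' A') (μ : S) : Δ.SatFO (e.onFO F) μ ↔ Δ'.SatFO F (e.proj μ) := by
  rw [SatFO, ← e.onFml_toFml, e.sat_onFml, SatFO]

theorem valid_onFml {F : Fml V' A' P'} : Δ.Valid (e.onFml F) ↔ Δ'.Valid F := by
  constructor
  · intro h ν'
    obtain ⟨μ⟩ := Δ.state_nonempty
    obtain ⟨ν, rfl, -⟩ := e.state_lift μ ν'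
    exact (e.sat_onFml F ν).1 (h ν)
  · exact fun h μ => (e.sat_onFml F μ).2 (h _)

theorem valueSet_onVar (v : V') : Δ.valueSet (e.onVar v) = Δ'.valueSet v := by
  ext δ
  constructor
  · rintro ⟨μ, rfl⟩
    exact ⟨e.proj μ, (e.eval_proj μ v).symm⟩
  · rintro ⟨ν', rfl⟩
    obtain ⟨μ⟩ := Δ.state_nonempty
    obtain ⟨ν, rfl, -⟩ := e.state_lift μ ν'
    exact ⟨ν, e.eval_proj ν v⟩

theorem bvSem_onProg_subset (p : P') : Δ.bvSem (e.onProg p) ⊆ e.onVar '' Δ'.bvSem p := by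
  rintro u ⟨μ, ν, h1, h2⟩
  by_cases hu : u ∈ Set.range e.onVar
  · obtain ⟨u, rfl⟩ := hu
    rw [e.eval_proj, e.eval_proj] at h2
    exact ⟨u, ⟨_, _, e.prog_proj h1, h2⟩, rfl⟩
  · exact absurd (e.prog_unchanged h1 u hu) h2

theorem fvSemProg_onProg_subset (p : P') :
    Δ.fvSemProg (e.onProg p) ⊆ e.onVar '' Δ'.fvSemProg p := by
  rintro u ⟨μ, μ', ν, h1, h2, h3⟩
  by_cases hu : u ∈ Set.range e.onVar
  · obtain ⟨u, rfl⟩ := hu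
    refine ⟨u, ⟨e.proj μ, e.proj μ', e.proj ν, fun x hx => ?_, e.prog_proj h2, ?_⟩, rfl⟩
    · rw [← e.eval_proj, ← e.eval_proj]
      exact h1 _ fun h => hx (e.onVar_injective h)
    · rintro ⟨ν', h4, h5⟩
      obtain ⟨κ, h6, rfl⟩ := e.prog_lift h5
      refine h3 ⟨κ, fun x hx => ?_, h6⟩
      by_cases hx' : x ∈ Set.range e.onVar
      · obtain ⟨x, rfl⟩ := hx'
        rw [e.eval_proj, e.eval_proj]
        exact h4 _ fun h => hx (congrArg e.onVar h)
      · rw [← e.prog_unchanged h2 x hx', ← e.prog_unchanged h6 x hx', h1 x hx]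
  -- A variable outside the part is invisible in the projections, so extensionality allows the
  -- projected run to be repeated from μ' and lifted.
  · refine absurd ?_ h3
    have h4 : Δ'.progEval p (e.proj μ') (e.proj ν) := by
      refine (Δ'.extensionality p _ _ _ fun v => ?_).1 (e.prog_proj h2)
      rw [← e.eval_proj, ← e.eval_proj]
      exact h1 _ fun h => hu ⟨v, h⟩
    obtain ⟨κ, h6, h7⟩ := e.prog_lift h4
    refine ⟨κ, fun x hx => ?_, h6⟩
    by_cases hx' : x ∈ Set.range e.onVar
    · obtain ⟨x, rfl⟩ := hx'
      rw [e.eval_proj, e.eval_proj, h7]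
    · rw [← e.prog_unchanged h2 x hx', ← e.prog_unchanged h6 x hx', h1 x hx]

theorem varSem_onProg_subset (p : P') : Δ.varSem (e.onProg p) ⊆ e.onVar '' Δ'.varSem p := by
  rintro u (hu | hu)
  · exact Set.image_mono Set.subset_union_left (e.fvSemProg_onProg_subset p hu)
  · exact Set.image_mono Set.subset_union_right (e.bvSem_onProg_subset p hu)

/-- Composition of embeddings. -/
def comp (e' : Embedding Δ'' Δ') : Embedding Δ'' Δ where
  onVar := e.onVar ∘ e'.onVar
  onAtom := e.onAtom ∘ e'.onAtom
  onProg := e.onProg ∘ e'.onProg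
  proj := e'.proj ∘ e.proj
  onVar_injective := e.onVar_injective.comp e'.onVar_injective
  eval_proj μ v := (e.eval_proj μ _).trans (e'.eval_proj _ v)
  atom_proj μ a := (e.atom_proj μ _).trans (e'.atom_proj _ a)
  prog_proj h := e'.prog_proj (e.prog_proj h)
  prog_unchanged {μ ν p} h := by
    intro u hu
    by_cases hu' : u ∈ Set.range e.onVar
    · obtain ⟨u, rfl⟩ := hu'
      rw [e.eval_proj, e.eval_proj]
      refine e'.prog_unchanged (e.prog_proj h) u ?_
      rintro ⟨x, rfl⟩
      exact hu ⟨x, rfl⟩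
    · exact e.prog_unchanged h u hu'
  prog_lift h := by
    obtain ⟨ν', h1, h2⟩ := e'.prog_lift h
    obtain ⟨ν, h3, h4⟩ := e.prog_lift h1
    exact ⟨ν, h3, by rw [Function.comp, h4, h2]⟩
  state_lift μ ν'' := by
    obtain ⟨ν', h1, h2⟩ := e'.state_lift (e.proj μ) ν''
    obtain ⟨ν, h3, h4⟩ := e.state_lift μ ν'
    refine ⟨ν, by rw [Function.comp, h3, h1], fun u hu => ?_⟩
    by_cases hu' : u ∈ Set.range e.onVar
    · obtain ⟨u, rfl⟩ := hu'
      rw [e.eval_proj, e.eval_proj, h3]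
      refine h2 u ?_
      rintro ⟨x, rfl⟩
      exact hu ⟨x, rfl⟩
    · exact h4 u hu'

theorem onFml_comp (e' : Embedding Δ'' Δ') (F : Fml V'' A'' P'') :
    (e.comp e').onFml F = e.onFml (e'.onFml F) :=
  (F.map_map e'.onVar e'.onAtom e'.onProg e.onVar e.onAtom e.onProg).symm

end Embedding

theorem eqOn_compl_range_of_surjective {Δ : DynTheory U V A P S} {f : V' → V}
    (hf : Function.Surjective f) (μ ν : S) : Δ.EqOn μ ν (Set.range f)ᶜ :=
  fun u hu => absurd (hf u) hu

/-- A theory embeds into its havoc lift. -/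
def embedHavoc (Δ : DynTheory U V A P S) : Embedding Δ Δ.havoc where
  onVar := id
  onAtom := id
  onProg := .inl
  proj := id
  onVar_injective := Function.injective_id
  eval_proj _ _ := rfl
  atom_proj _ _ := Iff.rfl
  prog_proj h := h
  prog_unchanged _ := eqOn_compl_range_of_surjective Function.surjective_id _ _
  prog_lift h := ⟨_, h, rfl⟩
  state_lift _ ν' := ⟨ν', rfl, eqOn_compl_range_of_surjective Function.surjective_id _ _⟩

/-- A theory embeds into its regular closure. -/
def embedRegular (Δ : DynTheory U V A P S) : Embedding Δ Δ.regular where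
  onVar := id
  onAtom := id
  onProg := .base
  proj := id
  onVar_injective := Function.injective_id
  eval_proj _ _ := rfl
  atom_proj _ _ := Iff.rfl
  prog_proj h := h
  prog_unchanged _ := eqOn_compl_range_of_surjective Function.surjective_id _ _
  prog_lift h := ⟨_, h, rfl⟩
  state_lift _ ν' := ⟨ν', rfl, eqOn_compl_range_of_surjective Function.surjective_id _ _⟩

variable {V₀ A₀ P₀ S₀ V₁ A₁ P₁ S₁ Ac : Type*}
  (Δ₀ : DynTheory U V₀ A₀ P₀ S₀) (Δ₁ : DynTheory U V₁ A₁ P₁ S₁) (Θ : HetAtoms Δ₀ Δ₁ Ac)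

/-- The first theory embeds into the simple heterogeneous theory. -/
def embedLeft : Embedding Δ₀ (simpleHet Δ₀ Δ₁ Θ) where
  onVar := .inl
  onAtom := .inl
  onProg := .inl
  proj := Prod.fst
  onVar_injective := Sum.inl_injective
  eval_proj _ _ := rfl
  atom_proj _ _ := Iff.rfl
  prog_proj h := h.1
  prog_unchanged h := by
    rintro (u | u) hu
    · exact absurd ⟨u, rfl⟩ hu
    · exact h.2 u trivial
  prog_lift {μ ν' _} h := ⟨(ν', μ.2), ⟨h, fun _ _ => rfl⟩, rfl⟩
  state_lift μ ν' := ⟨(ν', μ.2), rfl, by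
    rintro (u | u) hu
    · exact absurd ⟨u, rfl⟩ hu
    · rfl⟩

/-- The second theory embeds into the simple heterogeneous theory. -/
def embedRight : Embedding Δ₁ (simpleHet Δ₀ Δ₁ Θ) where
  onVar := .inr
  onAtom a := .inr (.inl a)
  onProg := .inr
  proj := Prod.snd
  onVar_injective := Sum.inr_injective
  eval_proj _ _ := rfl
  atom_proj _ _ := Iff.rfl
  prog_proj h := h.2
  prog_unchanged h := by
    rintro (u | u) hu
    · exact h.1 u trivial
    · exact absurd ⟨u, rfl⟩ hu
  prog_lift {μ ν' _} h := ⟨(μ.1, ν'), ⟨fun _ _ => rfl, h⟩, rfl⟩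
  state_lift μ ν' := ⟨(μ.1, ν'), rfl, by
    rintro (u | u) hu
    · rfl
    · exact absurd ⟨u, rfl⟩ hu⟩

end Embedding

/-! ### Soundness -/

section Soundness

theorem _root_.Calculus.Sound.derives {U V A P S : Type*} {C : Calculus V A P}
    {Δ : DynTheory U V A P S} (hC : C.Sound Δ) {Γ : Set (Fml V A P)} (hΓ : ∀ G ∈ Γ, Δ.Valid G)
    {F : Fml V A P} (h : C.Derives Γ F) : Δ.Valid F := by
  induction h with
  | hyp h => exact hΓ _ h
  | rule h _ ih => exact hC _ _ h ih

/-- Validity of the premises is reflected to the part, where the derivation is sound, and validity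
of the conclusion is preserved on the way back. -/
theorem Embedding.sound_reduction {U V A P S V' A' P' S' : Type*}
    {Δ' : DynTheory U V' A' P' S'} {Δ : DynTheory U V A P S} (e : Embedding Δ' Δ)
    {C : Calculus V' A' P'} (hC : C.Sound Δ') {L : List (Fml V' A' P')} {F : Fml V' A' P'}
    (h : C.Derives {G | G ∈ L} F) (hL : ∀ G ∈ L.map e.onFml, Δ.Valid G) : Δ.Valid (e.onFml F) :=
  e.valid_onFml.2 (hC.derives (fun _ hG => e.valid_onFml.1 (hL _ (List.mem_map_of_mem hG))) h)

theorem simpleHetCalculus_sound {U V₀ A₀ P₀ S₀ V₁ A₁ P₁ S₁ Ac : Type*}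
    (Δ₀ : DynTheory U V₀ A₀ P₀ S₀) (Δ₁ : DynTheory U V₁ A₁ P₁ S₁) (Θ : HetAtoms Δ₀ Δ₁ Ac)
    {C₀ : Calculus V₀ A₀ P₀} {C₁ : Calculus V₁ A₁ P₁} (h₀ : C₀.Sound Δ₀) (h₁ : C₁.Sound Δ₁) :
    (SimpleHetCalculus Δ₀ Δ₁ Θ C₀ C₁).Sound (simpleHet Δ₀ Δ₁ Θ) := by
  intro L F h hL
  cases h with
  | elementary h => exact elementaryRule_sound _ _ _ h hL
  | reduction₀ h => exact (embedLeft Δ₀ Δ₁ Θ).sound_reduction h₀ h hL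
  | reduction₁ h => exact (embedRight Δ₀ Δ₁ Θ).sound_reduction h₁ h hL

variable {U V A P S : Type*} (Δ : DynTheory U V A P S)

theorem havocCalculus_sound {C : Calculus V A P} (hC : C.Sound Δ) :
    (HavocCalculus Δ C).Sound Δ.havoc := by
  intro L F h hL
  cases h with
  | elementary h => exact elementaryRule_sound _ _ _ h hL
  | reduction h => exact Δ.embedHavoc.sound_reduction hC h hL
  | havoc v F => exact fun μ => (Δ.havoc.sat_iff _ _ μ).2 Iff.rfl

theorem regular_sat_toFml (F : FOFml V A) (μ : S) :
    Δ.regular.Sat (F.toFml _) μ ↔ Δ.SatFO F μ := by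
  rw [← FOFml.toFml_map_id RegProg.base]
  exact Δ.embedRegular.sat_onFml (F.toFml P) μ

theorem regular_sat_star_iff (p : RegProg V A P) (F : Fml V A (RegProg V A P)) (μ : S) :
    Δ.regular.Sat (.box (.star p) F) μ ↔
      Δ.regular.Sat F μ ∧ Δ.regular.Sat (.box p (.box (.star p) F)) μ := by
  constructor
  · exact fun h => ⟨h μ ⟨0, fun _ _ => rfl⟩, fun ν hν ω ⟨n, hn⟩ => h ω ⟨n + 1, ν, hν, hn⟩⟩
  · rintro ⟨h1, h2⟩ ω ⟨n, hn⟩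
    cases n with
    | zero => exact (Δ.regular.sat_iff_of_eval_eq F fun v => hn v trivial).1 h1
    | succ n =>
      obtain ⟨ν, h3, h4⟩ := hn
      exact h2 ν h3 ω ⟨n, h4⟩

theorem regular_sat_induction (p : RegProg V A P) (F : Fml V A (RegProg V A P)) {μ : S}
    (h : Δ.regular.Sat (.box (.star p) (.imp F (.box p F))) μ) (hμ : Δ.regular.Sat F μ) :
    Δ.regular.Sat (.box (.star p) F) μ := by
  rintro ω ⟨n, hn⟩
  induction n generalizing μ with
  | zero => exact (Δ.regular.sat_iff_of_eval_eq F fun v => hn v trivial).1 hμ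
  | succ n ih =>
    obtain ⟨ν, h1, h2⟩ := hn
    obtain ⟨h3, h4⟩ := (Δ.regular_sat_star_iff _ _ _).1 h
    exact ih (h4 ν h1) ((Δ.regular.sat_imp _ _ _).1 h3 hμ ν h1) h2

/-- Induction on the number of iterations, both for replaying a run after a change of $v$ and for
the invariance of $v$. -/
theorem notMem_varSem_star {p : RegProg V A P} {v : V} (hv : v ∉ Δ.regular.varSem p) :
    v ∉ Δ.regular.varSem (.star p) := by
  rintro (⟨μ, μ', ν, h1, ⟨n, h2⟩, h3⟩ | ⟨μ, ν, ⟨n, h1⟩, h2⟩)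
  · refine h3 ?_
    clear h3
    suffices H : ∃ ν', Δ.EqOn ν ν' {v}ᶜ ∧ Δ.iterate (Δ.regEval p) n μ' ν' from
      H.imp fun ν' h => ⟨h.1, n, h.2⟩
    induction n generalizing μ μ' with
    | zero => exact ⟨μ', fun u hu => (h2 u trivial).symm.trans (h1 u hu), fun _ _ => rfl⟩
    | succ n ih =>
      obtain ⟨κ, h3, h4⟩ := h2
      obtain ⟨κ', h5, h6⟩ : ∃ κ', Δ.EqOn κ κ' {v}ᶜ ∧ Δ.regEval p μ' κ' :=
        by_contra fun h => hv (Or.inl ⟨μ, μ', κ, h1, h3, h⟩)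
      obtain ⟨ν', h7, h8⟩ := ih κ κ' h5 h4
      exact ⟨ν', h7, κ', h6, h8⟩
  · refine h2 ?_
    clear h2
    induction n generalizing μ with
    | zero => exact h1 v trivial
    | succ n ih =>
      obtain ⟨κ, h3, h4⟩ := h1
      exact (Δ.regular.eval_eq_of_notMem_bvSem (fun h => hv (Or.inr h)) h3).trans (ih κ h4)

theorem sat_box_of_eqOn {p : P} {v : V} (hv : v ∉ Δ.varSem p) {F : Fml V A P} (hF : v ∉ Δ.fvSem F)
    {μ ν : S} (hμν : Δ.EqOn μ ν {v}ᶜ) (h : Δ.Sat (.box p F) μ) : Δ.Sat (.box p F) ν := by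
  refine (Δ.sat_box_all_comm hv F μ).2 (fun ω hω κ hκ => ?_) ν hμν
  exact Δ.sat_of_notMem_fvSem hF hκ (h ω hω)

theorem notMem_fvSem_all (v : V) (F : Fml V A P) : v ∉ Δ.fvSem (.all v F) :=
  Δ.notMem_fvSem fun _ _ h1 h2 ω hω => h2 ω (h1.trans hω)

theorem notMem_fvSem_neg {v : V} {F : Fml V A P} (h : v ∉ Δ.fvSem F) : v ∉ Δ.fvSem (.neg F) :=
  Δ.notMem_fvSem fun _ _ h1 h2 h3 => h2 (Δ.sat_of_notMem_fvSem h h1.symm h3)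

theorem notMem_fvSem_box {p : P} {v : V} (hv : v ∉ Δ.varSem p) {F : Fml V A P}
    (hF : v ∉ Δ.fvSem F) : v ∉ Δ.fvSem (.box p F) :=
  Δ.notMem_fvSem fun _ _ h1 h2 => Δ.sat_box_of_eqOn hv hF h1 h2

/-- Induction on the value of the counter $v$: each pass through the loop body allows it to decrease
by one while $F$ is kept, and at zero no further iteration is needed. -/
theorem convergenceAxiom_valid {N : NatData U V A} (hN : Δ.regular.InductivelyExpressive N)
    (p : RegProg V A P) (v w : N.VN) (F : Fml V A (RegProg V A P)) (hvw : v ≠ w)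
    (hw : (w : V) ∉ Δ.regular.fvSem F) (hvp : (v : V) ∉ Δ.regular.varSem p) :
    Δ.regular.Valid (convergenceAxiom N p v w F) := by
  have hwv : (w : V) ≠ v := fun h => hvw (Subtype.ext h.symm)
  intro μ
  rw [convergenceAxiom, sat_imp]
  intro h ν hν
  rw [sat_imp]
  intro hF
  have hstar := Δ.notMem_varSem_star hvp
  -- Neither the loop hypothesis nor the desired conclusion depends on $v$ (`hA`, `hE`), so $v$ may
  -- be reset between iterations.
  have hA := Δ.regular.notMem_fvSem_box hstar
    (Δ.regular.notMem_fvSem_all (v : V) (.imp (.and ((N.pos v).toFml _) F)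
      (.dia p (.all w (.imp ((N.succ w v).toFml _) (.all v (.imp ((N.eq v w).toFml _) F)))))))
  have hE := Δ.regular.notMem_fvSem_neg (Δ.regular.notMem_fvSem_box hstar
    (Δ.regular.notMem_fvSem_neg (Δ.regular.notMem_fvSem_neg (Δ.regular.notMem_fvSem_all (v : V)
      (.neg (.and (.neg ((N.pos v).toFml _)) F))))))
  replace h := Δ.regular.sat_of_notMem_fvSem hA hν h
  clear hν
  induction hn : N.toNat (Δ.regular.eval ν v) generalizing ν with
  | zero =>
    rw [sat_dia]
    refine ⟨ν, ⟨0, fun _ _ => rfl⟩, ?_⟩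
    rw [sat_ex]
    refine ⟨ν, fun _ _ => rfl, fun h0 => ?_, hF⟩
    have := (hN.pos_sound v ν).1 h0
    omega
  | succ n ih =>
    obtain ⟨h1, h2⟩ := (Δ.regular_sat_star_iff _ _ _).1 h
    have h3 := h1 ν fun _ _ => rfl
    rw [sat_imp, sat_dia] at h3
    obtain ⟨κ, h4, h5⟩ := h3 ⟨(hN.pos_sound v ν).2 (by omega), hF⟩
    have hκv : Δ.regular.eval ν v = Δ.regular.eval κ v :=
      Δ.regular.eval_eq_of_notMem_bvSem (fun h => hvp (Or.inr h)) h4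
    obtain ⟨κ₁, h6, h7⟩ := hN.exists_value w n κ
    obtain ⟨κ₂, h8, h9⟩ := hN.exists_value v n κ₁
    have h10 := (Δ.regular.sat_imp _ _ _).1 (h5 κ₁ h6)
      ((hN.succ_sound w v hvw.symm κ₁).2 (by rw [h7, ← h6 v hwv.symm, ← hκv, hn])) κ₂ h8
    have h11 := (Δ.regular.sat_imp _ _ _).1 h10
      ((hN.eq_sound v w hvw κ₂).2 (by rw [h9, ← h8 w hwv, h7]))
    -- This state is κ with the decremented counter. It differs from κ₂ only in $w$, so $F$ carries
    -- over, and from κ only in $v$, so the conclusion can be moved back to κ.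
    obtain ⟨κ₃, h12⟩ := Δ.regular.interpolation κ₂ κ {(v : V)}
    have hκκ₃ : Δ.regular.EqOn κ κ₃ {(v : V)}ᶜ := fun u hu => ((h12 u).2 hu).symm
    have hκ₂₃ : Δ.regular.EqOn κ₂ κ₃ {(w : V)}ᶜ := fun u hu => by
      by_cases huv : u = v
      · exact ((h12 u).1 huv).symm
      · rw [(h12 u).2 huv, ← h8 u huv, ← h6 u hu]
    have h13 := ih κ₃ (Δ.regular.sat_of_notMem_fvSem hw hκ₂₃ h11)
      (Δ.regular.sat_of_notMem_fvSem hA hκκ₃ (h2 κ h4)) (by rw [(h12 v).1 rfl, h9])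
    have h14 := Δ.regular.sat_of_notMem_fvSem hE hκκ₃.symm h13
    rw [← Fml.dia, sat_dia] at h14
    rw [sat_dia]
    obtain ⟨ω, ⟨m, h15⟩, h16⟩ := h14
    exact ⟨ω, ⟨m + 1, κ, h4, h15⟩, h16⟩

theorem regularCalculus_sound {C : Calculus V A P} (hC : C.Sound Δ) {𝒩 : Set (NatData U V A)}
    (h𝒩 : ∀ N ∈ 𝒩, Δ.regular.InductivelyExpressive N) :
    (RegularCalculus Δ C 𝒩).Sound Δ.regular := by
  intro L F h hL
  cases h with
  | elementary h => exact elementaryRule_sound _ _ _ h hL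
  | reduction h => exact Δ.embedRegular.sound_reduction hC h hL
  | test H F =>
    intro μ
    rw [sat_iff, sat_imp, regular_sat_toFml]
    exact ⟨fun h h1 => h μ ⟨h1, fun _ _ => rfl⟩, fun h ν hν =>
      (Δ.regular.sat_iff_of_eval_eq F fun v => hν.2 v trivial).1 (h hν.1)⟩
  | seq p q F =>
    intro μ
    rw [sat_iff]
    exact ⟨fun h ν hν ω hω => h ω ⟨ν, hν, hω⟩, fun h ω ⟨ν, hν, hω⟩ => h ν hν ω hω⟩
  | choice p q F =>
    intro μ
    rw [sat_iff]
    exact ⟨fun h => ⟨fun ν hν => h ν (Or.inl hν), fun ν hν => h ν (Or.inr hν)⟩,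
      fun h ν hν => hν.elim (h.1 ν) (h.2 ν)⟩
  | star p F => exact fun μ => (Δ.regular.sat_iff _ _ μ).2 (Δ.regular_sat_star_iff p F μ)
  | induction p F =>
    intro μ
    rw [sat_imp, sat_imp]
    exact Δ.regular_sat_induction p F
  | convergence N hN p v w F hvw hw hvp _ =>
    exact Δ.convergenceAxiom_valid (h𝒩 N hN) p v w F hvw hw hvp

end Soundness

end DynTheory

/-- Universal quantification over a list of variables. -/
def Fml.allList {V A P : Type*} (l : List V) (F : Fml V A P) : Fml V A P := l.foldr Fml.all F

theorem FOFml.toFml_allList {V A : Type*} (P : Type*) (l : List V) (F : FOFml V A) :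
    FOFml.toFml P (Fml.allList l F) = Fml.allList l (F.toFml P) := by
  induction l with
  | nil => rfl
  | cons v l ih =>
    change Fml.all v (FOFml.toFml P (Fml.allList l F)) = _
    rw [ih]
    rfl

namespace DynTheory

/-! ### Derived rules and elimination of modalities -/

section Deduction

variable {U V A P S : Type*} (Δ : DynTheory U V A P S)

theorem sat_allList (l : List V) (F : Fml V A P) (μ : S) :
    Δ.Sat (.allList l F) μ ↔ ∀ ν, Δ.EqOn μ ν {x | x ∈ l}ᶜ → Δ.Sat F ν := by
  induction l generalizing μ with
  | nil =>
    exact ⟨fun h ν hν => (Δ.sat_iff_of_eval_eq F fun v => hν v (by simp)).1 h,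
      fun h => h μ fun _ _ => rfl⟩
  | cons v l ih =>
    have hl : {x | x ∈ v :: l} = insert v {x | x ∈ l} := by ext; simp
    rw [hl, ← forall_eqOn_insert]
    exact forall₂_congr fun ν _ => ih ν

theorem notMem_fvSem_allList {l : List V} {v : V} (hv : v ∈ l) (F : Fml V A P) :
    v ∉ Δ.fvSem (.allList l F) :=
  Δ.notMem_fvSem fun μ ν h => by
    rw [sat_allList, sat_allList]
    refine fun h1 ω hω => h1 ω (EqOn.trans (h.mono fun u hu => ?_) hω)
    rintro rfl
    exact hu hv

/-- A set of valid formulas that contains the valid first-order formulas and is closed under the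
elementary rules. -/
structure Deductive (T : Fml V A P → Prop) : Prop where
  valid : ∀ {F}, T F → Δ.Valid F
  fo : ∀ {F : FOFml V A}, Δ.Valid (F.toFml P) → T (F.toFml P)
  elementary : ∀ {L F}, ElementaryRule Δ L F → (∀ G ∈ L, T G) → T F

namespace Deductive

variable {Δ} {T : Fml V A P → Prop}

theorem mp (hT : Δ.Deductive T) {F G : Fml V A P} (h : T (.imp F G)) (hF : T F) : T G :=
  hT.elementary (.mp F G) (by simp [h, hF])

/-- Propositional inferences are justified by truth tables: an implication true under all Boolean
assignments is an axiom, and modus ponens discharges its premise. -/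
theorem prop₁ (hT : Δ.Deductive T) {F G : Fml V A P} (hF : T F)
    (h : ∀ I : Fml V A P → Prop, (∀ G, I (.neg G) ↔ ¬ I G) →
      (∀ G H, I (.and G H) ↔ I G ∧ I H) → I F → I G) : T G :=
  hT.mp (hT.elementary (.taut _ fun I hn ha => by
    simpa [Fml.imp, hn, ha] using h I hn ha) (by simp)) hF

theorem prop₂ (hT : Δ.Deductive T) {F₁ F₂ G : Fml V A P} (hF₁ : T F₁) (hF₂ : T F₂)
    (h : ∀ I : Fml V A P → Prop, (∀ G, I (.neg G) ↔ ¬ I G) →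
      (∀ G H, I (.and G H) ↔ I G ∧ I H) → I F₁ → I F₂ → I G) : T G :=
  hT.mp (hT.prop₁ hF₁ fun I hn ha => by simpa [Fml.imp, hn, ha] using h I hn ha) hF₂

theorem prop₃ (hT : Δ.Deductive T) {F₁ F₂ F₃ G : Fml V A P} (hF₁ : T F₁) (hF₂ : T F₂) (hF₃ : T F₃)
    (h : ∀ I : Fml V A P → Prop, (∀ G, I (.neg G) ↔ ¬ I G) →
      (∀ G H, I (.and G H) ↔ I G ∧ I H) → I F₁ → I F₂ → I F₃ → I G) : T G :=
  hT.mp (hT.prop₂ hF₁ hF₂ fun I hn ha => by simpa [Fml.imp, hn, ha] using h I hn ha) hF₃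

theorem prop₄ (hT : Δ.Deductive T)
    {F₁ F₂ F₃ F₄ G : Fml V A P} (hF₁ : T F₁) (hF₂ : T F₂) (hF₃ : T F₃) (hF₄ : T F₄)
    (h : ∀ I : Fml V A P → Prop, (∀ G, I (.neg G) ↔ ¬ I G) →
      (∀ G H, I (.and G H) ↔ I G ∧ I H) → I F₁ → I F₂ → I F₃ → I F₄ → I G) : T G :=
  hT.mp (hT.prop₃ hF₁ hF₂ hF₃ fun I hn ha => by simpa [Fml.imp, hn, ha] using h I hn ha) hF₄

theorem imp_trans (hT : Δ.Deductive T)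
    {F G H : Fml V A P} (h₁ : T (.imp F G)) (h₂ : T (.imp G H)) : T (.imp F H) :=
  hT.prop₂ h₁ h₂ fun I hn ha => by simp only [Fml.imp, hn, ha]; tauto

theorem iff_intro (hT : Δ.Deductive T)
    {F G : Fml V A P} (h₁ : T (.imp F G)) (h₂ : T (.imp G F)) : T (.iff F G) :=
  hT.prop₂ h₁ h₂ fun I hn ha => by simp only [Fml.iff, ha]; tauto

theorem iff_mp (hT : Δ.Deductive T) {F G : Fml V A P} (h : T (.iff F G)) : T (.imp F G) :=
  hT.prop₁ h fun I hn ha => by simp only [Fml.iff, ha]; tauto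

theorem iff_mpr (hT : Δ.Deductive T) {F G : Fml V A P} (h : T (.iff F G)) : T (.imp G F) :=
  hT.prop₁ h fun I hn ha => by simp only [Fml.iff, ha]; tauto

theorem iff_symm (hT : Δ.Deductive T) {F G : Fml V A P} (h : T (.iff F G)) : T (.iff G F) :=
  hT.iff_intro (hT.iff_mpr h) (hT.iff_mp h)

theorem iff_trans (hT : Δ.Deductive T)
    {F G H : Fml V A P} (h₁ : T (.iff F G)) (h₂ : T (.iff G H)) : T (.iff F H) :=
  hT.iff_intro (hT.imp_trans (hT.iff_mp h₁) (hT.iff_mp h₂))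
    (hT.imp_trans (hT.iff_mpr h₂) (hT.iff_mpr h₁))

/-- The gateway from semantics to derivations: first-order implications only have to be verified in
all states. -/
theorem fo_imp (hT : Δ.Deductive T) {F G : FOFml V A} (h : ∀ μ, Δ.SatFO F μ → Δ.SatFO G μ) :
    T (.imp (F.toFml P) (G.toFml P)) :=
  hT.fo (F := .imp F G) fun μ => (Δ.sat_imp _ _ μ).2 (h μ)

theorem all_mono (hT : Δ.Deductive T)
    {F G : Fml V A P} (v : V) (h : T (.imp F G)) : T (.imp (.all v F) (.all v G)) :=
  hT.mp (hT.elementary (.allDistrib v F G) (by simp)) (hT.elementary (.gen v _) (by simpa))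

theorem all_congr (hT : Δ.Deductive T)
    {F G : Fml V A P} (v : V) (h : T (.iff F G)) : T (.iff (.all v F) (.all v G)) :=
  hT.iff_intro (hT.all_mono v (hT.iff_mp h)) (hT.all_mono v (hT.iff_mpr h))

theorem all_intro (hT : Δ.Deductive T)
    {F G : Fml V A P} {v : V} (hv : v ∉ Δ.fvSem F) (h : T (.imp F G)) :
    T (.imp F (.all v G)) :=
  hT.imp_trans (hT.elementary (.allVacuous v F hv) (by simp)) (hT.all_mono v h)

theorem box_mono (hT : Δ.Deductive T)
    {F G : Fml V A P} (p : P) (h : T (.imp F G)) : T (.imp (.box p F) (.box p G)) :=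
  hT.mp (hT.elementary (.K p F G) (by simp)) (hT.elementary (.G p _) (by simpa))

theorem box_congr (hT : Δ.Deductive T)
    {F G : Fml V A P} (p : P) (h : T (.iff F G)) : T (.iff (.box p F) (.box p G)) :=
  hT.iff_intro (hT.box_mono p (hT.iff_mp h)) (hT.box_mono p (hT.iff_mpr h))

theorem neg_congr (hT : Δ.Deductive T)
    {F G : Fml V A P} (h : T (.iff F G)) : T (.iff (.neg F) (.neg G)) :=
  hT.prop₁ h fun I hn ha => by simp only [Fml.iff, Fml.imp, hn, ha]; tauto

theorem and_congr (hT : Δ.Deductive T)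
    {F F' G G' : Fml V A P} (h : T (.iff F F')) (h' : T (.iff G G')) :
    T (.iff (.and F G) (.and F' G')) :=
  hT.prop₂ h h' fun I hn ha => by simp only [Fml.iff, Fml.imp, hn, ha]; tauto

theorem iff_refl (hT : Δ.Deductive T) (F : Fml V A P) : T (.iff F F) :=
  hT.elementary (.taut _ fun I hn ha => by simp only [Fml.iff, Fml.imp, hn, ha]; tauto) (by simp)

theorem allList_mono (hT : Δ.Deductive T) {F G : Fml V A P} (l : List V) (h : T (.imp F G)) :
    T (.imp (.allList l F) (.allList l G)) := by
  induction l with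
  | nil => exact h
  | cons v l ih => exact hT.all_mono v ih

theorem allList_elim (hT : Δ.Deductive T)
    (l : List V) (F : Fml V A P) : T (.imp (.allList l F) F) := by
  induction l with
  | nil => exact hT.iff_mp (hT.iff_refl F)
  | cons v l ih => exact hT.imp_trans (hT.elementary (.allElim v _) (by simp)) ih

theorem allList_intro (hT : Δ.Deductive T)
    {F G : Fml V A P} {l : List V} (hl : ∀ v ∈ l, v ∉ Δ.fvSem F)
    (h : T (.imp F G)) : T (.imp F (.allList l G)) := by
  induction l with
  | nil => exact h
  | cons v l ih =>
    exact hT.all_intro (hl v (by simp)) (ih fun u hu => hl u (by simp [hu]))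

theorem allList_box (hT : Δ.Deductive T)
    {p : P} {l : List V} (hl : ∀ v ∈ l, v ∉ Δ.varSem p) (F : Fml V A P) :
    T (.imp (.allList l (.box p F)) (.box p (.allList l F))) := by
  induction l with
  | nil => exact hT.iff_mp (hT.iff_refl _)
  | cons v l ih =>
    exact hT.imp_trans (hT.all_mono v (ih fun u hu => hl u (by simp [hu])))
      (hT.iff_mp (hT.elementary (.B p v _ (hl v (by simp))) (by simp)))

/-- If all modal formulas with a first-order postcondition are provably equivalent to first-order
formulas, then so are all formulas. -/
theorem exists_fo_iff (hT : Δ.Deductive T) (hbox : ∀ p (G : FOFml V A), ∃ R : FOFml V A,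
    T (.iff (R.toFml P) (.box p (G.toFml P)))) (F : Fml V A P) :
    ∃ R : FOFml V A, T (.iff (R.toFml P) F) := by
  induction F with
  | atom a => exact ⟨.atom a, hT.iff_refl _⟩
  | neg F ih =>
    obtain ⟨R, hR⟩ := ih
    exact ⟨.neg R, hT.neg_congr hR⟩
  | and F G ihF ihG =>
    obtain ⟨R, hR⟩ := ihF
    obtain ⟨R', hR'⟩ := ihG
    exact ⟨.and R R', hT.and_congr hR hR'⟩
  | all v F ih =>
    obtain ⟨R, hR⟩ := ih
    exact ⟨.all v R, hT.all_congr v hR⟩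
  | box p F ih =>
    obtain ⟨R, hR⟩ := ih
    obtain ⟨R', hR'⟩ := hbox p R
    exact ⟨R', hT.iff_trans hR' (hT.box_congr p hR)⟩

/-- Theorems are valid, so the first-order equivalent of a valid formula is itself valid, hence a
theorem. -/
theorem of_valid (hT : Δ.Deductive T) (hbox : ∀ p (G : FOFml V A), ∃ R : FOFml V A,
    T (.iff (R.toFml P) (.box p (G.toFml P)))) {F : Fml V A P} (hF : Δ.Valid F) : T F := by
  obtain ⟨R, hR⟩ := hT.exists_fo_iff hbox F
  exact hT.mp (hT.iff_mp hR) (hT.fo fun μ => ((Δ.sat_iff _ _ μ).1 (hT.valid hR μ)).2 (hF μ))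

/-- Provability of the first-order equivalent of a modality, given a first-order rendition `R` of
the program with respect to the equation `E`. -/
theorem box_of_rendition (hT : Δ.Deductive T) {p : P} {R E G : FOFml V A} {x w : List V}
    (hR : T (.iff (R.toFml P) (.dia p (E.toFml P))))
    (hbv : ∀ v ∈ Δ.bvSem p, v ∈ x) (hwp : ∀ v ∈ w, v ∉ Δ.varSem p)
    (hwG : ∀ v ∈ w, v ∉ Δ.fvSem (G.toFml P))
    (hw : ∀ μ, (∀ ν, Δ.EqOn μ ν {v | v ∈ w}ᶜ → Δ.SatFO E ν → Δ.SatFO G ν) → Δ.SatFO G μ)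
    (hx : ∀ μ ν, Δ.EqOn μ ν {v | v ∈ x}ᶜ → Δ.SatFO E μ → Δ.SatFO E ν → Δ.SatFO G μ →
      Δ.SatFO G ν) :
    T (.iff (FOFml.toFml P (.allList w (.imp R (.allList x (.imp E G)))))
      (.box p (G.toFml P))) := by
  -- With $E$ read as $\bar x\doteq\bar w$, this says that $G$ holds in the state described by $\bar
  -- w$. The variables bound in $p$ are not free in it, so rule V carries both it and its negation
  -- across $p$.
  set G' : FOFml V A := .allList x (.imp E G)
  have eG' : G'.toFml P = .allList x (.imp (E.toFml P) (G.toFml P)) := FOFml.toFml_allList P _ _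
  have eR : FOFml.toFml P (.allList w (.imp R G')) = .allList w (.imp (R.toFml P) (G'.toFml P)) :=
    FOFml.toFml_allList P _ _
  have hV : ∀ v ∈ Δ.bvSem p, v ∉ Δ.fvSem (G'.toFml P) := fun v hv => by
    rw [eG']
    exact Δ.notMem_fvSem_allList (hbv v hv) _
  have hV₁ : T (.imp (G'.toFml P) (.box p (G'.toFml P))) :=
    hT.elementary (.V p _ (Set.eq_empty_iff_forall_notMem.2 fun v hv => hV v hv.2 hv.1)) (by simp)
  have hV₂ : T (.imp (.neg (G'.toFml P)) (.box p (.neg (G'.toFml P)))) :=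
    hT.elementary (.V p _ (Set.eq_empty_iff_forall_notMem.2 fun v hv =>
      Δ.notMem_fvSem_neg (hV v hv.2) hv.1)) (by simp)
  rw [eR]
  refine hT.iff_intro ?_ ?_
  · have h1 : T (.imp (.box p (G'.toFml P)) (.box p (.imp (E.toFml P) (G.toFml P)))) := by
      refine hT.box_mono p ?_
      rw [eG']
      exact hT.allList_elim _ _
    have h2 : T (.imp (.box p (.neg (E.toFml P))) (.box p (.imp (E.toFml P) (G.toFml P)))) :=
      hT.box_mono p (hT.elementary (.taut _ fun I hn ha => by
        simp only [Fml.imp, hn, ha]; tauto) (by simp))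
    -- If $R$ fails, no run ends in $E$; if $G'$ holds, it still holds after every run. In both
    -- cases $[p](E\to G)$ follows.
    have h3 : T (.imp (.imp (R.toFml P) (G'.toFml P))
        (.box p (.imp (E.toFml P) (G.toFml P)))) :=
      hT.prop₄ hR hV₁ h1 h2 fun I hn ha => by
        simp only [Fml.iff, Fml.imp, Fml.dia, hn, ha]; tauto
    -- After $\forall\bar w$ has been moved inside by rule B, choosing $\bar w$ as a copy of $\bar
    -- x$ makes $E$ true.
    have h4 : T (.imp (.allList w (.imp (E.toFml P) (G.toFml P))) (G.toFml P)) := by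
      have := hT.fo_imp (F := .allList w (.imp E G)) (G := G) fun μ hμ => hw μ fun ν hν hE => by
        rw [SatFO, FOFml.toFml_allList, sat_allList] at hμ
        exact (Δ.sat_imp _ _ ν).1 (hμ ν hν) hE
      rwa [FOFml.toFml_allList] at this
    exact hT.imp_trans (hT.allList_mono w h3) (hT.imp_trans (hT.allList_box hwp _)
      (hT.box_mono p h4))
  -- If $R$ held but $G'$ failed, then $\neg G'$ would persist after $p$. A final state with $G$ and
  -- $E$ satisfies $G'$, so $[p]G$ would give $[p]\neg E$, against $R$.
  · have h1 : T (.imp (G.toFml P) (.imp (.neg (G'.toFml P)) (.neg (E.toFml P)))) := by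
      have := hT.fo_imp (F := .and G E) (G := G') fun μ hμ => by
        rw [SatFO, eG', sat_allList]
        exact fun ν hν => (Δ.sat_imp _ _ ν).2 fun hE => hx μ ν hν hμ.2 hE hμ.1
      refine hT.prop₁ (F := .imp (.and (G.toFml P) (E.toFml P)) (G'.toFml P)) this
        fun I hn ha => ?_
      simp only [Fml.imp, hn, ha]
      tauto
    have h2 := hT.elementary (.K p (.neg (G'.toFml P)) (.neg (E.toFml P))) (by simp)
    refine hT.allList_intro (fun v hv => Δ.notMem_fvSem_box (hwp v hv) (hwG v hv)) ?_
    exact hT.prop₄ hR hV₂ (hT.box_mono p h1) h2 fun I hn ha => by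
      simp only [Fml.iff, Fml.imp, Fml.dia, hn, ha]; tauto

end Deductive

theorem satFO_eqVec {eq : V → V → FOFml V A} (heq : Δ.IsEqPredicate eq) {a : V × V}
    {l : List (V × V)} (h : ∀ x ∈ a :: l, Δ.Twin x.1 x.2) (μ : S) :
    Δ.SatFO (eqVec eq a l) μ ↔ ∀ x ∈ a :: l, Δ.eval μ x.1 = Δ.eval μ x.2 := by
  induction l generalizing a with
  | nil => simpa [eqVec] using heq a.1 a.2 (h a (by simp)) μ
  | cons b l ih =>
    rw [List.forall_mem_cons]
    exact _root_.and_congr (heq a.1 a.2 (h a (by simp)) μ)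
      (ih fun x hx => h x (List.mem_cons_of_mem _ hx))

theorem varSem_finite {p : P} (h : (Δ.bvSem p).Finite) : (Δ.varSem p).Finite :=
  ((Δ.fvProg_finite p).subset (Δ.fvSemProg_subset_fvProg p)).union h

theorem FiniteSupport.bvSem_finite {Δ : DynTheory U V A P S} (h : Δ.FiniteSupport) (p : P) :
    (Δ.bvSem p).Finite :=
  let ⟨_, h1, h2⟩ := h
  (h2 p).subset (h1 p)

/-- Modalities of programs of an FOL expressive part of a theory are provably equivalent to
first-order formulas. -/
theorem Embedding.exists_fo_iff_box {V' A' P' S' : Type*} {Δ' : DynTheory U V' A' P' S'}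
    {Δ : DynTheory U V A P S} (e : Embedding Δ' Δ) {T : Fml V A P → Prop} (hT : Δ.Deductive T)
    (hfol : Δ'.FOLExpressive) [hne : Nonempty V'] (hΔ' : ∀ F, Δ'.Valid F → T (e.onFml F)) (p : P')
    (G : FOFml V A) :
    ∃ R : FOFml V A, T (.iff (R.toFml P) (.box (e.onProg p) (G.toFml P))) := by
  obtain ⟨eq, heq, hren⟩ := hfol.rendition
  have v₀ : V' := hne.some
  -- The extra variable keeps the vectors nonempty when $p$ has no variables.
  set X : Set V' := insert v₀ (Δ'.varSem p)
  have hX : X.Finite := (Δ'.varSem_finite (hfol.finite_support.bvSem_finite p)).insert _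
  obtain ⟨t, htinj, ht⟩ := hX.exists_injOn_fresh (fun x _ => hfol.infinite_variables x)
    (hX.union ((Δ.fvSyn_finite (G.toFml P)).preimage e.onVar_injective.injOn))
  have htX : ∀ x ∈ X, t x ∉ X := fun x hx h => (ht x hx).2 (Or.inl h)
  have htG : ∀ x ∈ X, e.onVar (t x) ∉ Δ.fvSyn (G.toFml P) := fun x hx h =>
    (ht x hx).2 (Or.inr h)
  set xs : List V' := hX.toFinset.toList with hxs
  have hmem : ∀ x, x ∈ xs ↔ x ∈ X := fun x => by simp [hxs]
  obtain ⟨a, l, hal⟩ : ∃ a l, xs.map (fun x => (x, t x)) = a :: l := by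
    refine List.exists_cons_of_ne_nil fun h => ?_
    have : v₀ ∈ xs := (hmem _).2 (Set.mem_insert _ _)
    simp [List.map_eq_nil_iff.1 h] at this
  have hpair : ∀ y ∈ a :: l, ∃ x ∈ X, y = (x, t x) := fun y hy => by
    rw [← hal] at hy
    obtain ⟨x, hx, rfl⟩ := List.mem_map.1 hy
    exact ⟨x, (hmem x).1 hx, rfl⟩
  have hpair' : ∀ x ∈ X, (x, t x) ∈ a :: l := fun x hx => by
    rw [← hal]
    exact List.mem_map.2 ⟨x, (hmem x).2 hx, rfl⟩
  have htwin : ∀ y ∈ a :: l, Δ'.Twin y.1 y.2 := fun y hy => by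
    obtain ⟨x, hx, rfl⟩ := hpair y hy
    exact (ht x hx).1
  obtain ⟨R, hR⟩ := hren p a l htwin
    (fun v hv => ⟨(v, t v), hpair' v (Set.mem_insert_of_mem _ hv), rfl⟩)
    (fun y hy z hz h => by
      obtain ⟨x, hx, rfl⟩ := hpair y hy
      obtain ⟨x', hx', rfl⟩ := hpair z hz
      exact htX x' hx' ((show x = t x' from h) ▸ hx))
  have hE : ∀ μ, Δ.SatFO (e.onFO (eqVec eq a l)) μ ↔
      ∀ x ∈ X, Δ.eval μ (e.onVar x) = Δ.eval μ (e.onVar (t x)) := fun μ => by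
    rw [e.satFO_onFO, Δ'.satFO_eqVec heq htwin]
    constructor
    · intro h x hx
      rw [e.eval_proj, e.eval_proj]
      exact h _ (hpair' x hx)
    · intro h y hy
      obtain ⟨x, hx, rfl⟩ := hpair y hy
      rw [← e.eval_proj, ← e.eval_proj]
      exact h x hx
  have hR' : T (.iff ((e.onFO R).toFml P) (.dia (e.onProg p) ((e.onFO (eqVec eq a l)).toFml P))) :=
    by
    rw [← e.onFml_toFml, ← e.onFml_toFml]
    exact hΔ' _ hR
  have hwmem : ∀ u ∈ xs.map (fun x => e.onVar (t x)), ∃ x ∈ X, e.onVar (t x) = u := fun u hu => by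
    obtain ⟨x, hx, rfl⟩ := List.mem_map.1 hu
    exact ⟨x, (hmem x).1 hx, rfl⟩
  refine ⟨_, hT.box_of_rendition (x := xs.map e.onVar) (w := xs.map fun x => e.onVar (t x)) hR'
    ?_ ?_ ?_ ?_ ?_⟩
  · intro u hu
    obtain ⟨x, hx, rfl⟩ := e.bvSem_onProg_subset p hu
    exact List.mem_map_of_mem ((hmem x).2 (Set.mem_insert_of_mem _ (Or.inr hx)))
  · rintro u hu hu'
    obtain ⟨x, hx, rfl⟩ := hwmem u hu
    obtain ⟨x', hx', h⟩ := e.varSem_onProg_subset p hu'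
    exact htX x hx (e.onVar_injective h ▸ Set.mem_insert_of_mem _ hx')
  · rintro u hu hu'
    obtain ⟨x, hx, rfl⟩ := hwmem u hu
    exact htG x hx (Δ.fvSem_subset_fvSyn _ hu')
  · intro μ hμ
    have hinj : Set.InjOn (fun x => e.onVar (t x)) X := fun x hx y hy h =>
      htinj hx hy (e.onVar_injective h)
    -- Each twin receives the value of its partner, which is admissible because twins have the same
    -- value set.
    obtain ⟨ν, h1, h2⟩ := Δ.exists_update (hX.image fun x => e.onVar (t x))
      (fun u => Δ.eval μ (e.onVar (Function.invFunOn (fun x => e.onVar (t x)) X u)))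
      (by
        rintro _ ⟨x, hx, rfl⟩
        rw [hinj.leftInvOn_invFunOn hx, e.valueSet_onVar, ← (ht x hx).1, e.eval_proj]
        exact Δ'.eval_mem_valueSet _ _) μ
    refine Δ.coincidence _ ν μ (fun u hu => (h2 u ?_).symm) (hμ ν (h2.mono fun u hu => ?_) ?_)
    · rintro ⟨x, hx, rfl⟩
      exact htG x hx hu
    · rintro ⟨x, hx, rfl⟩
      exact hu (List.mem_map.2 ⟨x, (hmem x).2 hx, rfl⟩)
    · rw [hE]
      intro x hx
      rw [h1 _ ⟨x, hx, rfl⟩, hinj.leftInvOn_invFunOn hx]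
      refine (h2 _ ?_).symm
      rintro ⟨y, hy, h⟩
      exact htX y hy (e.onVar_injective h ▸ hx)
  · intro μ ν hμν hμ hν
    rw [hE] at hμ hν
    -- Both states give $\bar x$ the values of the untouched twins, so they agree on every variable.
    refine Δ.coincidence _ μ ν fun u _ => ?_
    by_cases hu : u ∈ xs.map e.onVar
    · obtain ⟨x, hx, rfl⟩ := List.mem_map.1 hu
      rw [hmem] at hx
      rw [hμ x hx, hν x hx]
      refine hμν _ fun h => ?_
      obtain ⟨y, hy, h⟩ := List.mem_map.1 h
      exact htX x hx (e.onVar_injective h ▸ (hmem y).1 hy)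
    · exact hμν u hu

end Deduction

end DynTheory

/-- A derivation uses finitely many hypotheses, which is what the finite premise lists of the
reduction rules require. -/
theorem Calculus.Derives.exists_list {V A P : Type*} {C : Calculus V A P} {Γ : Set (Fml V A P)}
    {F : Fml V A P} (h : C.Derives Γ F) :
    ∃ L : List (Fml V A P), (∀ G ∈ L, G ∈ Γ) ∧ C.Derives {G | G ∈ L} F := by
  have mono : ∀ {Γ Γ' : Set (Fml V A P)} {F}, Γ ⊆ Γ' → C.Derives Γ F → C.Derives Γ' F := by
    intro Γ Γ' F hΓ h
    induction h with
    | hyp h => exact .hyp (hΓ h)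
    | rule h _ ih => exact .rule h ih
  induction h with
  | @hyp F h => exact ⟨[F], by simpa, .hyp (by simp)⟩
  | @rule L F h _ ih =>
    choose! M hM₁ hM₂ using ih
    refine ⟨L.flatMap M, fun G hG => ?_, .rule h fun G hG => mono (fun H hH => ?_) (hM₂ G hG)⟩
    · obtain ⟨G', h1, h2⟩ := List.mem_flatMap.1 hG
      exact hM₁ G' h1 G h2
    · exact List.mem_flatMap.2 ⟨G, hG, hH⟩

namespace DynTheory

/-! ### Regular programs and loops -/

section Regular

variable {U V A P S : Type*} (Δ : DynTheory U V A P S)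

theorem regular_bvSem_finite (h : ∀ p, (Δ.bvSem p).Finite) (p : RegProg V A P) :
    (Δ.regular.bvSem p).Finite := by
  induction p with
  | base r => exact h r
  | seq p q ihp ihq =>
    refine (ihp.union ihq).subset ?_
    rintro v ⟨μ, ν, ⟨κ, h1, h2⟩, h3⟩
    by_contra hv
    exact h3 ((Δ.regular.eval_eq_of_notMem_bvSem (fun h => hv (Or.inl h)) h1).trans
      (Δ.regular.eval_eq_of_notMem_bvSem (fun h => hv (Or.inr h)) h2))
  | choice p q ihp ihq =>
    refine (ihp.union ihq).subset ?_
    rintro v ⟨μ, ν, h1 | h1, h3⟩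
    · exact Or.inl ⟨μ, ν, h1, h3⟩
    · exact Or.inr ⟨μ, ν, h1, h3⟩
  | test F =>
    refine Set.finite_empty.subset ?_
    rintro v ⟨μ, ν, h1, h3⟩
    exact h3 (h1.2 v trivial)
  | star p ih =>
    refine ih.subset ?_
    rintro v ⟨μ, ν, ⟨n, h1⟩, h3⟩
    by_contra hv
    refine h3 ?_
    clear h3
    induction n generalizing μ with
    | zero => exact h1 v trivial
    | succ n ihn =>
      obtain ⟨κ, h4, h5⟩ := h1
      exact (Δ.regular.eval_eq_of_notMem_bvSem hv h4).trans (ihn κ h5)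

/-- The two sides differ only at length zero, where iteration may move to another state with the
same values; `Q` cannot tell such states apart. -/
theorem reach_iff_exists_iterate {p : RegProg V A P} {Q : S → Prop}
    (hQ : ∀ μ ν, Δ.EqOn μ ν Set.univ → Q μ → Q ν) {k : ℕ} {μ : S} :
    Δ.regular.Reach p Q k μ ↔ ∃ ω, Δ.iterate (Δ.regEval p) k μ ω ∧ Q ω := by
  induction k generalizing μ with
  | zero => exact ⟨fun h => ⟨μ, fun _ _ => rfl, h⟩, fun ⟨ω, h1, h2⟩ => hQ ω μ h1.symm h2⟩
  | succ k ih =>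
    constructor
    · rintro ⟨ν, h1, h2⟩
      obtain ⟨ω, h3, h4⟩ := ih.1 h2
      exact ⟨ω, ⟨ν, h1, h3⟩, h4⟩
    · rintro ⟨ω, ⟨ν, h1, h3⟩, h4⟩
      exact ⟨ν, h1, ih.2 ⟨ω, h3, h4⟩⟩

variable (C : Calculus V A P) (𝒩 : Set (NatData U V A))

/-- The valid formulas that the calculus of the regular closure derives from the valid first-order
formulas. -/
def RegularTheorem (F : Fml V A (RegProg V A P)) : Prop :=
  (RegularCalculus Δ C 𝒩).Derives
    {H | ∃ G : FOFml V A, H = G.toFml _ ∧ Δ.regular.Valid H} F ∧ Δ.regular.Valid F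

/-- Validity is recorded alongside derivability, so completeness does not depend on soundness of the
underlying calculus. -/
theorem deductive_regularTheorem : Δ.regular.Deductive (Δ.RegularTheorem C 𝒩) where
  valid h := h.2
  fo h := ⟨.hyp ⟨_, rfl, h⟩, h⟩
  elementary h hL :=
    ⟨.rule (.elementary h) fun G hG => (hL G hG).1,
      Δ.regular.elementaryRule_sound _ _ h fun G hG => (hL G hG).2⟩

variable {C 𝒩}

/-- An axiom available over every underlying calculus is available over the empty one, which is
trivially sound; so the axiom is valid. -/
theorem RegularTheorem.of_rule (h𝒩 : ∀ N ∈ 𝒩, Δ.regular.InductivelyExpressive N)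
    {F : Fml V A (RegProg V A P)} (h : ∀ C, RegularCalculus Δ C 𝒩 [] F) :
    Δ.RegularTheorem C 𝒩 F :=
  ⟨.rule (h C) (by simp), Δ.regularCalculus_sound (C := fun _ _ => False)
    (fun _ _ h => h.elim) h𝒩 _ _ (h _) (by simp)⟩

/-- The equivalent is $\forall v\,\neg F$, where $F$ says that $\neg G$ is reachable in exactly $v$
iterations. It is a loop invariant, and $F$ is a variant for reaching $\neg G$. -/
theorem exists_fo_iff_box_star
    (h𝒩 : ∀ N ∈ 𝒩, Δ.regular.InductivelyExpressive N) {N : NatData U V A} (hN : N ∈ 𝒩)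
    (hinf : N.VN.Infinite) (hcode : ∀ v, Δ.regular.SequenceCoding N v)
    {p : RegProg V A P} (hbv : (Δ.regular.bvSem p).Finite)
    (hp : ∀ G : FOFml V A, ∃ R : FOFml V A,
      Δ.RegularTheorem C 𝒩 (.iff (R.toFml _) (.box p (G.toFml _)))) (G : FOFml V A) :
    ∃ R : FOFml V A, Δ.RegularTheorem C 𝒩 (.iff (R.toFml _) (.box (.star p) (G.toFml _))) := by
  have hT := Δ.deductive_regularTheorem C 𝒩
  have hI := h𝒩 N hN
  -- Valid statements about a single run of $p$ between first-order conditions are provable, since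
  -- the modality of $p$ has already been eliminated; likewise for `hdia`.
  have hbox : ∀ {R G : FOFml V A}, (∀ μ, Δ.regular.SatFO R μ →
      ∀ ν, Δ.regular.progEval p μ ν → Δ.regular.SatFO G ν) →
      Δ.RegularTheorem C 𝒩 (.imp (R.toFml _) (.box p (G.toFml _))) := by
    intro R G h
    obtain ⟨R', hR'⟩ := hp G
    exact hT.imp_trans (hT.fo_imp fun μ hμ => ((sat_iff _ _ _ μ).1 (hT.valid hR' μ)).2 (h μ hμ))
      (hT.iff_mp hR')
  have hdia : ∀ {R G : FOFml V A}, (∀ μ, Δ.regular.SatFO R μ →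
      ∃ ν, Δ.regular.progEval p μ ν ∧ Δ.regular.SatFO G ν) →
      Δ.RegularTheorem C 𝒩 (.imp (R.toFml _) (.dia p (G.toFml _))) := by
    intro R G h
    obtain ⟨R', hR'⟩ := hp (.neg G)
    refine hT.imp_trans (hT.fo_imp (G := .neg R') fun μ hμ hμ' => ?_)
      (hT.iff_mp (hT.neg_congr hR'))
    obtain ⟨ν, h1, h2⟩ := h μ hμ
    exact ((sat_iff _ _ _ μ).1 (hT.valid hR' μ)).1 hμ' ν h1 h2
  have hdef : ∀ Q, Δ.regular.Definable Q →
      Δ.regular.Definable fun μ => ∃ ν, Δ.regular.progEval p μ ν ∧ Q ν := by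
    rintro Q ⟨F, hF⟩
    obtain ⟨R, hR⟩ := hp (.neg F)
    refine (definable_satFO R).not.congr fun μ => ?_
    rw [SatFO, (sat_iff _ _ _ μ).1 (hT.valid hR μ), sat_box]
    push Not
    exact exists_congr fun ν => and_congr_right fun _ => not_not.trans (hF ν)
  set X : Set V := Δ.regular.fvProg p ∪ Δ.regular.bvSem p ∪ Δ.regular.fvSyn (G.toFml _)
  have hX : X.Finite := ((Δ.regular.fvProg_finite p).union hbv).union (Δ.regular.fvSyn_finite _)
  have hfvX : Δ.regular.fvProg p ⊆ X := fun u hu => Or.inl (Or.inl hu)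
  have hvarX : Δ.regular.varSem p ⊆ X := by
    rintro u (hu | hu)
    · exact hfvX (Δ.regular.fvSemProg_subset_fvProg p hu)
    · exact Or.inl (Or.inr hu)
  have hQ : ∀ μ ν, Δ.regular.EqOn μ ν X → Δ.regular.SatFO (.neg G) μ →
      Δ.regular.SatFO (.neg G) ν := fun μ ν h =>
    Δ.regular.coincidence _ μ ν (h.mono fun u hu => Or.inr hu)
  obtain ⟨v', hv'N, hv'X⟩ := hinf.exists_notMem_finite hX
  obtain ⟨w', hw'N, hw'X⟩ := hinf.exists_notMem_finite (hX.insert v')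
  obtain ⟨v, rfl⟩ : ∃ n : N.VN, (n : V) = v' := ⟨⟨v', hv'N⟩, rfl⟩
  obtain ⟨w, rfl⟩ : ∃ n : N.VN, (n : V) = w' := ⟨⟨w', hw'N⟩, rfl⟩
  simp only [Set.mem_insert_iff, not_or] at hw'X
  have hvw : v ≠ w := fun h => hw'X.1 (h ▸ rfl)
  have hwv : (w : V) ≠ v := hw'X.1
  obtain ⟨F, hF⟩ := definable_reach hI hinf hcode hdef hbv (.neg G) v
  beta_reduce at hF
  have hreach : ∀ {k μ ν}, Δ.regular.EqOn μ ν X →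
      Δ.regular.Reach p (Δ.regular.SatFO (.neg G)) k μ →
      Δ.regular.Reach p (Δ.regular.SatFO (.neg G)) k ν := fun h => Reach.transfer hfvX hQ h
  have hoffv : ∀ {μ ν}, Δ.regular.EqOn μ ν {(v : V)}ᶜ → Δ.regular.EqOn μ ν X := fun h =>
    h.mono fun u hu => by rintro rfl; exact hv'X hu
  have hoffw : ∀ {μ ν}, Δ.regular.EqOn μ ν {(w : V)}ᶜ → Δ.regular.EqOn μ ν X := fun h =>
    h.mono fun u hu => by rintro rfl; exact hw'X.2 hu
  have hR : ∀ μ, Δ.regular.SatFO (.all v (.neg F)) μ ↔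
      Δ.regular.Sat (.box (.star p) (G.toFml _)) μ := by
    intro μ
    have hR₁ : Δ.regular.SatFO (.all v (.neg F)) μ ↔
        ∀ k, ¬ Δ.regular.Reach p (Δ.regular.SatFO (.neg G)) k μ := by
      constructor
      · intro h k hk
        obtain ⟨ν, h1, h2⟩ := hI.exists_value v k μ
        exact h ν h1 ((hF ν).2 (h2 ▸ hreach (hoffv h1) hk))
      · exact fun h ν hν hνF => h _ (hreach (hoffv hν.symm) ((hF ν).1 hνF))
    have hQ' : ∀ μ ν, Δ.EqOn μ ν Set.univ → Δ.regular.SatFO (.neg G) μ →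
        Δ.regular.SatFO (.neg G) ν := fun μ ν h => hQ μ ν fun u _ => h u trivial
    rw [hR₁]
    simp only [Δ.reach_iff_exists_iterate hQ']
    constructor
    · rintro h ω ⟨n, hn⟩
      by_contra hω
      exact h n ⟨ω, hn, hω⟩
    · rintro h k ⟨ω, h1, h2⟩
      exact h2 (h ω ⟨k, h1⟩)
  refine ⟨.all v (.neg F), hT.iff_intro ?_ ?_⟩
  -- As $R$ expresses $[p^*]G$, both $R\to[p]R$ and $R\to G$ are valid; induction applies.
  · set R : FOFml V A := .all v (.neg F)
    have h1 : Δ.RegularTheorem C 𝒩 (.imp (R.toFml _) (.box p (R.toFml _))) :=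
      hbox fun μ hμ ν hν => by
        rw [hR] at hμ ⊢
        exact ((Δ.regular_sat_star_iff _ _ _).1 hμ).2 ν hν
    have h2 : Δ.RegularTheorem C 𝒩 (.imp (R.toFml _) (G.toFml _)) := hT.fo_imp fun μ hμ =>
      ((Δ.regular_sat_star_iff _ _ _).1 ((hR μ).1 hμ)).1
    exact hT.imp_trans (hT.mp (RegularTheorem.of_rule Δ h𝒩 fun _ => .induction p _)
      (hT.elementary (.G _ _) (by simpa using h1))) (hT.box_mono _ h2)
  -- With $k+1$ iterations to go, some run of $p$ leaves $k$ to go, so $F$ holds again once $v$ is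
  -- lowered to $k$.
  · have h1 : Δ.RegularTheorem C 𝒩 (.imp (.and ((N.pos v).toFml _) (F.toFml _))
        (.dia p (.all w (.imp ((N.succ w v).toFml _)
          (.all v (.imp ((N.eq v w).toFml _) (F.toFml _))))))) := by
      refine hdia (R := .and (N.pos v) F)
        (G := .all w (.imp (N.succ w v) (.all v (.imp (N.eq v w) F)))) fun μ hμ => ?_
      have hpos := (hI.pos_sound v μ).1 hμ.1
      have hrun := (hF μ).1 hμ.2
      obtain ⟨k, hk⟩ : ∃ k, N.toNat (Δ.regular.eval μ v) = k + 1 :=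
        ⟨_, (Nat.succ_pred_eq_of_pos hpos).symm⟩
      rw [hk] at hrun
      obtain ⟨ν, h1, h2⟩ := hrun
      have hνv := Δ.regular.eval_eq_of_notMem_bvSem (fun h => hv'X (hvarX (Or.inr h))) h1
      refine ⟨ν, h1, fun ν₁ hν₁ => (sat_imp _ _ _ _).2 fun hs ν₂ hν₂ =>
        (sat_imp _ _ _ _).2 fun he => (hF ν₂).2 ?_⟩
      have hs' := (hI.succ_sound w v hvw.symm ν₁).1 hs
      have he' := (hI.eq_sound v w hvw ν₂).1 he
      rw [← hν₁ v hwv.symm, ← hνv, hk] at hs'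
      rw [← hν₂ w hwv] at he'
      rw [show N.toNat (Δ.regular.eval ν₂ v) = k by omega]
      exact hreach (hoffv hν₂) (hreach (hoffw hν₁) h2)
    have hwF : (w : V) ∉ Δ.regular.fvSem (F.toFml _) := by
      refine Δ.regular.notMem_fvSem fun μ ν h hμ => (hF ν).2 ?_
      rw [← h v hwv.symm]
      exact hreach (hoffw h) ((hF μ).1 hμ)
    have h2 := hT.mp (RegularTheorem.of_rule Δ h𝒩 fun C => RegularCalculus.convergence N hN p v w
        (F.toFml _) hvw hwF (fun h => hv'X (hvarX h)) (fun h => hw'X.2 (hvarX h)))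
      (hT.elementary (.G _ _) (by simpa using hT.elementary (.gen (v : V) _) (by simpa using h1)))
    have h3 := hT.mp (hT.elementary (.allElim _ _) (by simp)) h2
    -- At counter zero, $F$ says that $\neg G$ holds already. So $[p^*]G$ refutes the outcome
    -- promised by convergence, and hence $F$.
    have h4 : Δ.RegularTheorem C 𝒩
        (.imp (G.toFml _) (.neg (.ex v (.and (.neg ((N.pos v).toFml _)) (F.toFml _))))) := by
      refine hT.fo_imp (G := .neg (.ex v (.and (.neg (N.pos v)) F))) fun μ hμ h => ?_
      obtain ⟨ν, h5, h6, h7⟩ := (sat_ex _ _ _ _).1 h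
      have h8 : ¬ 0 < N.toNat (Δ.regular.eval ν v) := fun h => h6 ((hI.pos_sound v ν).2 h)
      have h9 := hreach (hoffv h5.symm) ((hF ν).1 h7)
      rw [show N.toNat (Δ.regular.eval ν v) = 0 by omega] at h9
      exact h9 hμ
    refine hT.all_intro (fun h => ?_) (hT.prop₂ (G := .imp _ (.neg (F.toFml _))) h3
      (hT.box_mono (.star p) h4) fun I hn ha => by
      simp only [Fml.imp, Fml.dia, hn, ha]; tauto)
    rcases Δ.regular.fvSem_subset_fvSyn _ h with h | h
    · exact hv'X (hfvX h)
    · exact hv'X (Or.inr h)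

/-- Provable first-order equivalents of modalities extend from the base programs to all regular
programs. -/
theorem exists_fo_iff_box_regular
    (h𝒩 : ∀ N ∈ 𝒩, Δ.regular.InductivelyExpressive N) {N : NatData U V A} (hN : N ∈ 𝒩)
    (hinf : N.VN.Infinite) (hcode : ∀ v, Δ.regular.SequenceCoding N v)
    (hbv : ∀ p, (Δ.bvSem p).Finite)
    (hbase : ∀ r (G : FOFml V A), ∃ R : FOFml V A,
      Δ.RegularTheorem C 𝒩 (.iff (R.toFml _) (.box (.base r) (G.toFml _))))
    (p : RegProg V A P) : ∀ G : FOFml V A, ∃ R : FOFml V A,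
      Δ.RegularTheorem C 𝒩 (.iff (R.toFml _) (.box p (G.toFml _))) := by
  have hT := Δ.deductive_regularTheorem C 𝒩
  induction p with
  | base r => exact hbase r
  | seq p q ihp ihq =>
    intro G
    obtain ⟨R, hR⟩ := ihq G
    obtain ⟨R', hR'⟩ := ihp R
    exact ⟨R', hT.iff_trans (hT.iff_trans hR' (hT.box_congr p hR))
      (hT.iff_symm (RegularTheorem.of_rule Δ h𝒩 fun _ => .seq p q _))⟩
  | choice p q ihp ihq =>
    intro G
    obtain ⟨R, hR⟩ := ihp G
    obtain ⟨R', hR'⟩ := ihq G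
    exact ⟨.and R R', hT.iff_trans (hT.and_congr hR hR')
      (hT.iff_symm (RegularTheorem.of_rule Δ h𝒩 fun _ => .choice p q _))⟩
  | test H =>
    exact fun G => ⟨.imp H G, hT.iff_symm (RegularTheorem.of_rule Δ h𝒩 fun _ => .test H _)⟩
  | star p ih =>
    exact exists_fo_iff_box_star Δ h𝒩 hN hinf hcode (Δ.regular_bvSem_finite hbv p) ih

end Regular

/-! ### Heterogeneous theories -/

section Embedding

variable {U V A P S V' A' P' S' : Type*} {Δ' : DynTheory U V' A' P' S'} {Δ : DynTheory U V A P S}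

/-- Sequence codes of a part of a theory can be used with any other counting data that can be
compared with the counting data of the part. -/
theorem Embedding.sequenceCoding (e : Embedding Δ' Δ) {N' : NatData U V' A'}
    (hgoe : Δ'.GoedelExpressive N') (htwin : ∀ v, {w | Δ'.Twin v w}.Infinite)
    {N : NatData U V A}
    (hcom : ∀ (n : N.VN) (n' : N'.VN), (n : V) ≠ e.onVar n' →
      Δ.Definable fun μ => N.toNat (Δ.eval μ n) = N'.toNat (Δ.eval μ (e.onVar n')))
    (x : V') : Δ.SequenceCoding N (e.onVar x) := by
  have hI := hgoe.inductively_expressive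
  obtain ⟨w, G, hG⟩ := hgoe.goedel_formulas x
  -- The coding formula understands only counters of the part, so $n$ and $j$ are copied to fresh
  -- counters $n'$ and $j'$. Freshness ensures that quantifying over the copies disturbs neither the
  -- code, nor $x$, nor the originals.
  have hform : ∀ (w' : V') (n j : N.VN), ∃ (n' j' : N'.VN) (F : FOFml V A), n' ≠ j' ∧
      (n' : V') ≠ w' ∧ (j' : V') ≠ w' ∧ (n' : V') ≠ x ∧ (j' : V') ≠ x ∧
      (∀ k ∈ ({n, j} : Set N.VN), (k : V) ≠ e.onVar n' ∧ (k : V) ≠ e.onVar j') ∧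
      ∀ μ, Δ.SatFO F μ ↔ ∃ ν, Δ.EqOn μ ν {e.onVar n', e.onVar j'}ᶜ ∧
        (N.toNat (Δ.eval ν n) = N'.toNat (Δ.eval ν (e.onVar n')) ∧
          N.toNat (Δ.eval ν j) = N'.toNat (Δ.eval ν (e.onVar j'))) ∧
        Δ'.SatFO (G w' n' j' x) (e.proj ν) := by
    intro w' n j
    have hB : ({w', x} ∪ e.onVar ⁻¹' {(n : V), (j : V)}).Finite :=
      (Set.toFinite _).union ((Set.toFinite _).preimage e.onVar_injective.injOn)
    obtain ⟨n', hn'N, hn'⟩ := hgoe.infinite_nat_variables.exists_notMem_finite hB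
    obtain ⟨j', hj'N, hj'⟩ := hgoe.infinite_nat_variables.exists_notMem_finite (hB.insert n')
    simp only [Set.mem_insert_iff, Set.mem_union, Set.mem_singleton_iff, Set.mem_preimage,
      not_or] at hn' hj'
    obtain ⟨⟨hn'w, hn'x⟩, hn'n, hn'j⟩ := hn'
    obtain ⟨hj'n', ⟨hj'w, hj'x⟩, hj'n, hj'j⟩ := hj'
    obtain ⟨F, hF⟩ := (((hcom n ⟨n', hn'N⟩ (Ne.symm hn'n)).and
      (hcom j ⟨j', hj'N⟩ (Ne.symm hj'j))).and
        (definable_satFO (e.onFO (G w' ⟨n', hn'N⟩ ⟨j', hj'N⟩ x)))).ex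
      (Set.toFinite {e.onVar n', e.onVar j'})
    refine ⟨⟨n', hn'N⟩, ⟨j', hj'N⟩, F, fun h => hj'n' (congrArg Subtype.val h).symm, hn'w, hj'w,
      hn'x, hj'x, ?_, fun μ => ?_⟩
    · rintro k (rfl | rfl)
      · exact ⟨Ne.symm hn'n, Ne.symm hj'n⟩
      · exact ⟨Ne.symm hn'j, Ne.symm hj'j⟩
    · simpa only [e.satFO_onFO] using hF μ
  choose n' j' F hne hnw hjw hnx hjx hfresh hF using hform
  have : Nonempty V' := ⟨x⟩
  refine ⟨e.onVar '' {w' | Δ'.Twin w w'}, fun u => F (Function.invFun e.onVar u),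
    (htwin w).image e.onVar_injective.injOn, fun K δ hδ => ?_⟩
  obtain ⟨ε, hε, hεG⟩ := hG K δ fun k => by
    rw [← e.valueSet_onVar]
    exact hδ k
  refine ⟨ε, ?_⟩
  rintro _ ⟨w', hw', rfl⟩
  beta_reduce
  rw [Function.leftInverse_invFun e.onVar_injective]
  refine ⟨by rwa [e.valueSet_onVar, ← hw'], fun n j μ hμw hμn => ?_⟩
  specialize hne w' n j
  specialize hnw w' n j
  specialize hjw w' n j
  specialize hnx w' n j
  specialize hjx w' n j
  have hn := hfresh w' n j n (by simp)
  have hj := hfresh w' n j j (by simp)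
  rw [hF]
  generalize n' w' n j = n' at *
  generalize j' w' n j = j' at *
  -- Any correct copies of the counters give the same answer; it remains below to see that correct
  -- copies exist.
  have key : ∀ ν, Δ.EqOn μ ν {e.onVar n', e.onVar j'}ᶜ →
      N.toNat (Δ.eval ν n) = N'.toNat (Δ.eval ν (e.onVar n')) →
      N.toNat (Δ.eval ν j) = N'.toNat (Δ.eval ν (e.onVar j')) →
      (Δ'.SatFO (G w' n' j' x) (e.proj ν) ↔
        ∃ k : Fin K, N.toNat (Δ.eval μ j) = (k : ℕ) + 1 ∧ Δ.eval μ (e.onVar x) = δ k) := by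
    intro ν hν hνn hνj
    rw [hεG n' j' w' x hw' rfl (e.proj ν), ← e.eval_proj, ← e.eval_proj, ← hνj,
      ← hν j (by simp [hj]),
      ← hν (e.onVar x) (by simp [e.onVar_injective.eq_iff, hnx.symm, hjx.symm])]
    · rw [← e.eval_proj,
        ← hν (e.onVar w') (by simp [e.onVar_injective.eq_iff, hnw.symm, hjw.symm]), hμw]
    · rw [← e.eval_proj, ← hνn, ← hν n (by simp [hn]), hμn]
  constructor
  · rintro ⟨ν, h1, ⟨h2, h3⟩, h4⟩
    exact (key ν h1 h2 h3).1 h4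
  · intro h
    obtain ⟨κ₁, hκ₁⟩ := hI.integer_expressive n' n'.2 (N.toNat (Δ.eval μ n))
    obtain ⟨κ₂, hκ₂⟩ := hI.integer_expressive j' j'.2 (N.toNat (Δ.eval μ j))
    obtain ⟨μ₁, h1, h2⟩ := Δ.exists_update_singleton (v := e.onVar n')
      (by rw [e.valueSet_onVar]; exact Δ'.eval_mem_valueSet κ₁ n') μ
    obtain ⟨ν, h3, h4⟩ := Δ.exists_update_singleton (v := e.onVar j')
      (by rw [e.valueSet_onVar]; exact Δ'.eval_mem_valueSet κ₂ j') μ₁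
    have hμν : Δ.EqOn μ ν {e.onVar n', e.onVar j'}ᶜ := fun u hu => by
      simp only [Set.mem_compl_iff, Set.mem_insert_iff, Set.mem_singleton_iff, not_or] at hu
      rw [h2 u hu.1, h4 u hu.2]
    have hνn : N.toNat (Δ.eval ν n) = N'.toNat (Δ.eval ν (e.onVar n')) := by
      rw [← hμν n (by simp [hn]), ← h4 (e.onVar n')
        (fun h => hne (Subtype.ext (e.onVar_injective h))), h1, hκ₁]
    have hνj : N.toNat (Δ.eval ν j) = N'.toNat (Δ.eval ν (e.onVar j')) := by
      rw [← hμν j (by simp [hj]), h3, hκ₂]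
    exact ⟨ν, hμν, ⟨hνn, hνj⟩, (key ν hμν hνn hνj).2 h⟩

/-- The finitely many first-order assumptions of a derivation remain first-order and valid after
translation, so one reduction step suffices. -/
theorem Embedding.derives_onFml (e : Embedding Δ' Δ) {C' : Calculus V' A' P'} {C : Calculus V A P}
    (hC : ∀ (L : List (Fml V' A' P')) F, C'.Derives {G | G ∈ L} F → C (L.map e.onFml) (e.onFml F))
    {F : Fml V' A' P'} (h : C'.Derives {H | ∃ G : FOFml V' A', H = G.toFml P' ∧ Δ'.Valid H} F) :
    C.Derives {H | ∃ G : FOFml V A, H = G.toFml P ∧ Δ.Valid H} (e.onFml F) := by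
  obtain ⟨L, hL, hLF⟩ := h.exists_list
  refine .rule (hC L F hLF) fun H hH => ?_
  obtain ⟨G, hG, rfl⟩ := List.mem_map.1 hH
  obtain ⟨G', rfl, hG'⟩ := hL G hG
  exact .hyp ⟨e.onFO G', e.onFml_toFml G', e.valid_onFml.2 hG'⟩

end Embedding

section Heterogeneous

variable {U V₀ A₀ P₀ S₀ V₁ A₁ P₁ S₁ Ac : Type*}
  (Δ₀ : DynTheory U V₀ A₀ P₀ S₀) (Δ₁ : DynTheory U V₁ A₁ P₁ S₁) (Θ : HetAtoms Δ₀ Δ₁ Ac)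

/-- The simple heterogeneous theory embeds into the fully heterogeneous theory. -/
def embedSimple : Embedding (simpleHet Δ₀ Δ₁ Θ) (fullHet Δ₀ Δ₁ Θ) :=
  (embedRegular _).comp (embedHavoc _)

theorem embedSimple_onFml (F : Fml (V₀ ⊕ V₁) (A₀ ⊕ A₁ ⊕ Ac) (P₀ ⊕ P₁)) :
    (embedSimple Δ₀ Δ₁ Θ).onFml F =
      (simpleHet Δ₀ Δ₁ Θ).havoc.embedRegular.onFml ((simpleHet Δ₀ Δ₁ Θ).embedHavoc.onFml F) :=
  Embedding.onFml_comp _ _ F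

/-- The first theory embeds into the fully heterogeneous theory. -/
def embedFullLeft : Embedding Δ₀ (fullHet Δ₀ Δ₁ Θ) :=
  (embedSimple Δ₀ Δ₁ Θ).comp (embedLeft Δ₀ Δ₁ Θ)

/-- The second theory embeds into the fully heterogeneous theory. -/
def embedFullRight : Embedding Δ₁ (fullHet Δ₀ Δ₁ Θ) :=
  (embedSimple Δ₀ Δ₁ Θ).comp (embedRight Δ₀ Δ₁ Θ)

theorem inductivelyExpressive_lift₀ {N : NatData U V₀ A₀} (hN : Δ₀.InductivelyExpressive N) :
    (fullHet Δ₀ Δ₁ Θ).InductivelyExpressive (N.lift₀ V₁ A₁ Ac) := by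
  have hsat := (embedFullLeft Δ₀ Δ₁ Θ).satFO_onFO
  obtain ⟨ν₁⟩ := Δ₁.state_nonempty
  constructor
  · rintro (v | v) hv n
    · obtain ⟨μ, hμ⟩ := hN.integer_expressive v hv n
      exact ⟨(μ, ν₁), hμ⟩
    · exact hv.elim
  · rintro ⟨v | v, hv⟩ μ
    · exact (hsat _ μ).trans (hN.pos_sound ⟨v, hv⟩ μ.1)
    · exact hv.elim
  · rintro ⟨v | v, hv⟩ ⟨w | w, hw⟩ hne μ
    · exact (hsat _ μ).trans (hN.eq_sound ⟨v, hv⟩ ⟨w, hw⟩ (fun h => hne (by cases h; rfl)) μ.1)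
    · exact hw.elim
    · exact hv.elim
    · exact hv.elim
  · rintro ⟨v | v, hv⟩ ⟨w | w, hw⟩ hne μ
    · exact (hsat _ μ).trans (hN.succ_sound ⟨v, hv⟩ ⟨w, hw⟩ (fun h => hne (by cases h; rfl)) μ.1)
    · exact hw.elim
    · exact hv.elim
    · exact hv.elim

theorem inductivelyExpressive_lift₁ {N : NatData U V₁ A₁} (hN : Δ₁.InductivelyExpressive N) :
    (fullHet Δ₀ Δ₁ Θ).InductivelyExpressive (N.lift₁ V₀ A₀ Ac) := by
  have hsat := (embedFullRight Δ₀ Δ₁ Θ).satFO_onFO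
  obtain ⟨ν₀⟩ := Δ₀.state_nonempty
  constructor
  · rintro (v | v) hv n
    · exact hv.elim
    · obtain ⟨μ, hμ⟩ := hN.integer_expressive v hv n
      exact ⟨(ν₀, μ), hμ⟩
  · rintro ⟨v | v, hv⟩ μ
    · exact hv.elim
    · exact (hsat _ μ).trans (hN.pos_sound ⟨v, hv⟩ μ.2)
  · rintro ⟨v | v, hv⟩ ⟨w | w, hw⟩ hne μ
    · exact hv.elim
    · exact hv.elim
    · exact hw.elim
    · exact (hsat _ μ).trans (hN.eq_sound ⟨v, hv⟩ ⟨w, hw⟩ (fun h => hne (by cases h; rfl)) μ.2)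
  · rintro ⟨v | v, hv⟩ ⟨w | w, hw⟩ hne μ
    · exact hv.elim
    · exact hv.elim
    · exact hw.elim
    · exact (hsat _ μ).trans (hN.succ_sound ⟨v, hv⟩ ⟨w, hw⟩ (fun h => hne (by cases h; rfl)) μ.2)

/-- Counters always come from the first theory. For variables of the first theory they are compared
by its own equality formula, for variables of the second by the communication formula. -/
theorem sequenceCoding_fullHet {N₀ : NatData U V₀ A₀} {N₁ : NatData U V₁ A₁}
    (hfol₀ : Δ₀.FOLExpressive) (hfol₁ : Δ₁.FOLExpressive) (hgoe₀ : Δ₀.GoedelExpressive N₀)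
    (hgoe₁ : Δ₁.GoedelExpressive N₁) (hcom : Communicating Δ₀ Δ₁ Θ N₀ N₁) (v : V₀ ⊕ V₁) :
    (fullHet Δ₀ Δ₁ Θ).SequenceCoding (N₀.lift₀ V₁ A₁ Ac) v := by
  obtain v | v := v
  · refine (embedFullLeft Δ₀ Δ₁ Θ).sequenceCoding hgoe₀ hfol₀.infinite_variables ?_ v
    rintro ⟨n | n, hn⟩ n' hne
    · refine ⟨(embedFullLeft Δ₀ Δ₁ Θ).onFO (N₀.eq ⟨n, hn⟩ n'), fun μ => ?_⟩
      rw [Embedding.satFO_onFO]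
      refine hgoe₀.inductively_expressive.eq_sound ⟨n, hn⟩ n' (fun h => hne ?_) μ.1
      exact congrArg Sum.inl (congrArg Subtype.val h)
    · exact hn.elim
  · refine (embedFullRight Δ₀ Δ₁ Θ).sequenceCoding hgoe₁ hfol₁.infinite_variables ?_ v
    obtain ⟨natEq, hnatEq⟩ := hcom.nat_communication
    rintro ⟨n | n, hn⟩ n' -
    · refine ⟨(embedSimple Δ₀ Δ₁ Θ).onFO (natEq ⟨n, hn⟩ n'), fun μ => ?_⟩
      rw [Embedding.satFO_onFO]
      exact hnatEq ⟨n, hn⟩ n' μ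
    · exact hn.elim

theorem havoc_simpleHet_bvSem_finite (h₀ : Δ₀.FiniteSupport) (h₁ : Δ₁.FiniteSupport)
    (p : HavocProg (V₀ ⊕ V₁) (P₀ ⊕ P₁)) : ((simpleHet Δ₀ Δ₁ Θ).havoc.bvSem p).Finite := by
  obtain (p | p) | v := p
  · exact ((h₀.bvSem_finite p).image _).subset ((embedLeft Δ₀ Δ₁ Θ).bvSem_onProg_subset p)
  · exact ((h₁.bvSem_finite p).image _).subset ((embedRight Δ₀ Δ₁ Θ).bvSem_onProg_subset p)
  · refine (Set.finite_singleton v).subset ?_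
    rintro u ⟨μ, ν, h1, h2⟩
    by_contra hu
    exact h2 (h1 u hu)

end Heterogeneous

end DynTheory

/-! ### The main theorem -/

theorem mainTheorem1 {U V₀ A₀ P₀ S₀ V₁ A₁ P₁ S₁ Ac : Type*}
    (Δ₀ : DynTheory U V₀ A₀ P₀ S₀) (Δ₁ : DynTheory U V₁ A₁ P₁ S₁)
    (Θ : DynTheory.HetAtoms Δ₀ Δ₁ Ac)
    (N₀ : NatData U V₀ A₀) (N₁ : NatData U V₁ A₁)
    (C₀ : Calculus V₀ A₀ P₀) (C₁ : Calculus V₁ A₁ P₁)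
    (hfin₀ : Δ₀.FiniteSupport) (hfin₁ : Δ₁.FiniteSupport)
    (hfol₀ : Δ₀.FOLExpressive) (hfol₁ : Δ₁.FOLExpressive)
    (hgoe₀ : Δ₀.GoedelExpressive N₀) (hgoe₁ : Δ₁.GoedelExpressive N₁)
    (hrel₀ : C₀.RelativelyComplete Δ₀) (hrel₁ : C₁.RelativelyComplete Δ₁)
    (hcom : DynTheory.Communicating Δ₀ Δ₁ Θ N₀ N₁) :
    (FullHetCalculus Δ₀ Δ₁ Θ N₀ N₁ C₀ C₁).RelativelyComplete (DynTheory.fullHet Δ₀ Δ₁ Θ) ∧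
      (C₀.Sound Δ₀ → C₁.Sound Δ₁ →
        (FullHetCalculus Δ₀ Δ₁ Θ N₀ N₁ C₀ C₁).Sound (DynTheory.fullHet Δ₀ Δ₁ Θ)) := by
  have h𝒩 : ∀ N ∈ ({N₀.lift₀ V₁ A₁ Ac, N₁.lift₁ V₀ A₀ Ac} : Set (NatData U (V₀ ⊕ V₁) _)),
      (fullHet Δ₀ Δ₁ Θ).InductivelyExpressive N := by
    rintro N (rfl | rfl)
    · exact inductivelyExpressive_lift₀ Δ₀ Δ₁ Θ hgoe₀.inductively_expressive
    · exact inductivelyExpressive_lift₁ Δ₀ Δ₁ Θ hgoe₁.inductively_expressive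
  refine ⟨fun F hF => ?_, fun h₀ h₁ => regularCalculus_sound _
    (havocCalculus_sound _ (simpleHetCalculus_sound Δ₀ Δ₁ Θ h₀ h₁)) h𝒩⟩
  have hne₀ : Nonempty V₀ := hgoe₀.infinite_nat_variables.nonempty.to_type
  have hne₁ : Nonempty V₁ := hgoe₁.infinite_nat_variables.nonempty.to_type
  have hinf : (N₀.lift₀ V₁ A₁ Ac).VN.Infinite :=
    (hgoe₀.infinite_nat_variables.image Sum.inl_injective.injOn).mono (by
      rintro _ ⟨v, hv, rfl⟩
      exact hv)
  have hT := deductive_regularTheorem (simpleHet Δ₀ Δ₁ Θ).havoc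
    (HavocCalculus (simpleHet Δ₀ Δ₁ Θ) (SimpleHetCalculus Δ₀ Δ₁ Θ C₀ C₁))
    {N₀.lift₀ V₁ A₁ Ac, N₁.lift₁ V₀ A₀ Ac}
  -- Derivations in the simple heterogeneous theory pass through the reduction rules of the havoc
  -- and regular layers.
  have hlift : ∀ F, (SimpleHetCalculus Δ₀ Δ₁ Θ C₀ C₁).Derives
      {H | ∃ G : FOFml _ _, H = G.toFml _ ∧ (simpleHet Δ₀ Δ₁ Θ).Valid H} F →
      (FullHetCalculus Δ₀ Δ₁ Θ N₀ N₁ C₀ C₁).Derives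
        {H | ∃ G : FOFml _ _, H = G.toFml _ ∧ (fullHet Δ₀ Δ₁ Θ).Valid H}
        ((embedSimple Δ₀ Δ₁ Θ).onFml F) := fun F hF => by
    rw [embedSimple_onFml]
    exact (embedRegular _).derives_onFml (fun _ _ => RegularCalculus.reduction)
      ((embedHavoc _).derives_onFml (fun _ _ => HavocCalculus.reduction) hF)
  refine (hT.of_valid (fun p G => exists_fo_iff_box_regular _ h𝒩 (Set.mem_insert _ _) hinf
    (sequenceCoding_fullHet Δ₀ Δ₁ Θ hfol₀ hfol₁ hgoe₀ hgoe₁ hcom)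
    (havoc_simpleHet_bvSem_finite Δ₀ Δ₁ Θ hfin₀ hfin₁) ?_ p G) hF).1
  rintro ((p | p) | v) G
  -- Relative completeness of the component calculus supplies the rendition equivalence as a
  -- theorem.
  · refine (embedFullLeft Δ₀ Δ₁ Θ).exists_fo_iff_box hT hfol₀ (fun F hF => ⟨?_, ?_⟩) p G
    · rw [embedFullLeft, Embedding.onFml_comp]
      exact hlift _ ((embedLeft Δ₀ Δ₁ Θ).derives_onFml
        (fun _ _ => SimpleHetCalculus.reduction₀) (hrel₀ F hF))
    · exact (embedFullLeft Δ₀ Δ₁ Θ).valid_onFml.2 hF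
  · refine (embedFullRight Δ₀ Δ₁ Θ).exists_fo_iff_box hT hfol₁ (fun F hF => ⟨?_, ?_⟩) p G
    · rw [embedFullRight, Embedding.onFml_comp]
      exact hlift _ ((embedRight Δ₀ Δ₁ Θ).derives_onFml
        (fun _ _ => SimpleHetCalculus.reduction₁) (hrel₁ F hF))
    · exact (embedFullRight Δ₀ Δ₁ Θ).valid_onFml.2 hF
  -- The havoc axiom belongs to the middle layer and is imported by one reduction step.
  · refine ⟨.all v G, hT.iff_symm ⟨?_, fun μ => (sat_iff _ _ _ μ).2 Iff.rfl⟩⟩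
    have h := (embedRegular (simpleHet Δ₀ Δ₁ Θ).havoc).derives_onFml
      (C := FullHetCalculus Δ₀ Δ₁ Θ N₀ N₁ C₀ C₁) (fun _ _ => RegularCalculus.reduction)
      (.rule (HavocCalculus.havoc v (G.toFml _)) (by simp))
    change Calculus.Derives _ _ (.iff (.box _ ((G.toFml _).map id id _))
      (.all v ((G.toFml _).map id id _))) at h
    rwa [FOFml.toFml_map_id] at h
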